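/- For $\theta\in[0,1]$ let $\mathcal H_2(\theta)=-\theta\log_2\theta-(1-\theta)\log_2(1-\theta)$ (with $0\log_2 0=0$), and for real $\rho$ with $0\le\rho<1$ let $\mathcal H_4(\rho)$ be defined by $$2^{\mathcal H_4(\rho)}=\inf_{x>0}\ x^{-3\rho}(1+x+x^2+x^3),$$ where the infimum is attained (a minimum) if $0<\rho<1$. The function $x\mapsto \mathcal H_2(1-2x)+\mathcal H_2(x)$ has a unique maximum point $x_0$ on $[1/4,1/2]$, and the system $$\mathcal H_4(\rho)=\mathcal H_2(\theta)+\mathcal H_2(1-2\theta),\qquad \mathcal H_4(1-2\rho)=1+\mathcal H_2(1-2\theta)$$ has a unique solution $(\theta,\rho)=(\theta_1,\rho_0)$ with $\theta\in[x_0,1/2]$ and $\rho\in[1/4,1/2]$; here $\rho_0\approx 0.32$ (precisely, $|\rho_0-0.32|<0.005$). A non-trivial three-term progression in a finite group $G$ is a triple $(a,b,c)$ of mutually distinct elements with $ac=b^2$, and $r_3(G)$ is the largest size of a subset of $G$ containing no non-trivial three-term progression. Let $C_8$ be the cyclic group of order $8$ and $n\ge 0$. If $A\subset C_8^n$ contains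 no non-trivial three-term progression, then $$|A|\le\left(2\cdot 2^{\mathcal H_4(\rho_0)}\right)^n,\qquad\text{where } 2\cdot 2^{\mathcal H_4(\rho_0)}\approx 7.0899\ \text{ (precisely, } |2\cdot 2^{\mathcal H_4(\rho_0)}-7.0899|<0.00005).$$ In particular, $r_3(C_8^n)\le (7.09)^n$, which improves exponentially on the earlier bound $(2\kappa_4)^n$, where $\kappa_4=2^{\mathcal H_4(1/3)}=\min_{x>0}x^{-1}(1+x+x^2+x^3)$: one has $2\kappa_4\approx 7.22$ (precisely, $|2\kappa_4-7.22|<0.005$), and so $7.09<2\kappa_4$. -/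

import Mathlib

open Set

/-- The ordered triple `(a, b, c)` is a non-trivial three-term progression in the group `G`:
its members are mutually distinct and `a * c = b ^ 2`. -/
def IsNontrivialProgression {G : Type*} [Group G] (a b c : G) : Prop :=
  a ≠ b ∧ b ≠ c ∧ a ≠ c ∧ a * c = b ^ 2

/-- The set `A` contains no non-trivial three-term progression. Unlike for Mathlib's
`ThreeGPFree`, the progressions `(a, b, a)` with `a ≠ b` and `a ^ 2 = b ^ 2` are allowed. -/
def ProgressionFree {G : Type*} [Group G] (A : Set G) : Prop :=
  ∀ a ∈ A, ∀ b ∈ A, ∀ c ∈ A, ¬ IsNontrivialProgression a b c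

/-- The largest size of a subset of the finite group `G` without non-trivial three-term
progressions. -/
noncomputable def r3 (G : Type*) [Group G] [Finite G] : ℕ :=
  sSup {k : ℕ | ∃ A : Finset G, ProgressionFree (A : Set G) ∧ A.card = k}

/-- The group `C_8 ^ n`, written multiplicatively. -/
abbrev C8pow (n : ℕ) : Type := Fin n → Multiplicative (ZMod 8)

/-- The binary entropy function with base-2 logarithms:
`-θ log₂ θ - (1 - θ) log₂ (1 - θ)` (with value `0` at `θ = 0` and `θ = 1`). -/
noncomputable def H2 (θ : ℝ) : ℝ := Real.binEntropy θ / Real.log 2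

/-- The function `x ↦ x ^ (-3ρ) (1 + x + x² + x³)`, to be minimized over `x > 0`. -/
noncomputable def weight4 (ρ x : ℝ) : ℝ :=
  x ^ (-3 * ρ) * (1 + x + x ^ 2 + x ^ 3)

/-- `H4 ρ = log₂ (inf_{x > 0} x ^ (-3ρ) (1 + x + x² + x³))`. -/
noncomputable def H4 (ρ : ℝ) : ℝ := Real.logb 2 (sInf (weight4 ρ '' Ioi 0))

/-- `x₀` is a maximum point of `x ↦ H2 (1 - 2x) + H2 x` on `[1/4, 1/2]`. -/
def IsMaxPoint (x₀ : ℝ) : Prop :=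
  x₀ ∈ Icc (1 / 4 : ℝ) (1 / 2) ∧
    IsMaxOn (fun x : ℝ => H2 (1 - 2 * x) + H2 x) (Icc (1 / 4) (1 / 2)) x₀

/-- `(θ, ρ)`, with `θ ∈ [x₀, 1/2]` and `ρ ∈ [1/4, 1/2]`, solves the system of two entropy
equations. -/
def SolvesSystem (x₀ θ ρ : ℝ) : Prop :=
  θ ∈ Icc x₀ (1 / 2) ∧ ρ ∈ Icc (1 / 4 : ℝ) (1 / 2) ∧
    H4 ρ = H2 θ + H2 (1 - 2 * θ) ∧
    H4 (1 - 2 * ρ) = 1 + H2 (1 - 2 * θ)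

/-! The bound comes from a two-level polynomial method over 𝔽₂. For q = 2, 4, products of binomial
coefficients serve as monomials for functions on (ℤ/q)^n. If P has degree at most 2d+1 and the
matrix P(α i + β j) is diagonal with nonzero diagonal, then its size is at most twice the number of
monomials of degree ≤ d (`card_le_of_diagonal`). Also, a prescribed set D supports a P of degree ≤ d
having no more zeros on D than there are monomials of degree > d (`exists_binomEval_large_support`).

Level one takes D = A mod 4. For a, a' in A of equal parity, (a + a')/2 mod 4 lies in D only if a =
a', so each of the 2^n parity classes contains few a with P(a mod 4) ≠ 0. The other elements of A
lie over the few residues where P vanishes. Level two applies the same argument with q = 2, to the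
middle and top bits, and shows that few residues have large fibers. Summing over fiber sizes gives
`AddProgressionFree.card_le`.

With cutoffs d ≈ 3ρn and j₀ ≈ θn, exponential moments bound every count by an entropy. The first
equation of the system balances the large fibers against the first term, and the second does the
same for the fibers below the cutoff. Every term is then at most a polynomial factor times
(2·2^H4(ρ))^n, and passing to powers of A removes that factor.

Monotonicity of the entropies makes the solution unique. The intermediate value theorem and
certified logarithms locate it. -/

/-! ### The polynomial method over 𝔽₂ with binomial coefficients -/

/-- The binomial coefficient function on `ZMod q`, with values mod 2. -/
def binomMod (q : ℕ) (e x : ZMod q) : ZMod 2 := (x.val.choose e.val : ZMod 2)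

/-- For these moduli the binomial coefficient functions are inverted by the transposed
matrix, and satisfy the Vandermonde addition formula. -/
structure BinomGood (q : ℕ) [NeZero q] : Prop where
  inv : ∀ x y : ZMod q, ∑ e, binomMod q e y * binomMod q x e = if x = y then 1 else 0
  add : ∀ e x y : ZMod q, binomMod q e (x + y) =
    ∑ p : ZMod q × ZMod q,
      (if p.1.val + p.2.val = e.val then 1 else 0) * (binomMod q p.1 x * binomMod q p.2 y)

/-- Over ℤ, the sum of C(y,e)·C(e,x) over e is 2^(y-x)·C(y,x), hence δ modulo 2. Vandermonde
survives reduction modulo a power of two q, because C(q,e) is even for 0 < e < q. -/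
theorem binomGood_two : BinomGood 2 := ⟨by decide, by decide⟩

set_option maxRecDepth 100000 in
theorem binomGood_four : BinomGood 4 := ⟨by decide, by decide⟩

/-- The total degree of an exponent vector. -/
def expDeg {q n : ℕ} (e : Fin n → ZMod q) : ℕ := ∑ i, (e i).val

/-- The number of exponent vectors of degree at most `d`. -/
def lowCount (q n d : ℕ) [NeZero q] : ℕ :=
  (Finset.univ.filter fun e : Fin n → ZMod q => expDeg e ≤ d).card

/-- The number of exponent vectors of degree larger than `d`. -/
def highCount (q n d : ℕ) [NeZero q] : ℕ :=
  (Finset.univ.filter fun e : Fin n → ZMod q => d < expDeg e).card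

/-- The product of binomial coefficient functions with exponent vector `e`. -/
def binomProd {q n : ℕ} (e x : Fin n → ZMod q) : ZMod 2 := ∏ i, binomMod q (e i) (x i)

/-- The function with binomial coefficients `c`. -/
def binomEval {q n : ℕ} [NeZero q] (c : (Fin n → ZMod q) → ZMod 2) (x : Fin n → ZMod q) :
    ZMod 2 := ∑ e, c e * binomProd e x

theorem binomProd_inv {q n : ℕ} [NeZero q] (h : BinomGood q) (x y : Fin n → ZMod q) :
    ∑ e, binomProd e y * binomProd x e = if x = y then 1 else 0 := by
  have h1 : ∀ e : Fin n → ZMod q, binomProd e y * binomProd x e =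
      ∏ i, (binomMod q (e i) (y i) * binomMod q (x i) (e i)) := by
    intro e; simp [binomProd, Finset.prod_mul_distrib]
  simp_rw [h1]
  rw [← Fintype.prod_sum (fun i (a : ZMod q) => binomMod q a (y i) * binomMod q (x i) a)]
  simp_rw [h.inv]
  by_cases hxy : x = y
  · simp [hxy]
  · obtain ⟨i, hi⟩ := Function.ne_iff.mp hxy
    rw [if_neg hxy]
    exact Finset.prod_eq_zero (Finset.mem_univ i) (by simp [hi])

theorem binomProd_add {q n : ℕ} [NeZero q] (h : BinomGood q) (e x y : Fin n → ZMod q) :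
    binomProd e (x + y) = ∑ s : Fin n → ZMod q, ∑ t : Fin n → ZMod q,
      (if ∀ i, (s i).val + (t i).val = (e i).val then 1 else 0) *
        (binomProd s x * binomProd t y) := by
  unfold binomProd
  simp_rw [Pi.add_apply, h.add]
  rw [Fintype.prod_sum (fun i (p : ZMod q × ZMod q) =>
    (if p.1.val + p.2.val = (e i).val then (1 : ZMod 2) else 0) *
      (binomMod q p.1 (x i) * binomMod q p.2 (y i)))]
  rw [← Fintype.sum_prod_type']
  refine Fintype.sum_equiv (Equiv.arrowProdEquivProdArrow (Fin n) (fun _ => ZMod q)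
    (fun _ => ZMod q)) _ _ ?_
  intro p
  change _ = (if ∀ i, (p i).1.val + (p i).2.val = (e i).val then (1 : ZMod 2) else 0) *
    ((∏ i, binomMod q (p i).1 (x i)) * ∏ i, binomMod q (p i).2 (y i))
  rw [Finset.prod_mul_distrib, Finset.prod_mul_distrib]
  congr 1
  by_cases hp : ∀ i, (p i).1.val + (p i).2.val = (e i).val
  · simp [hp]
  · rw [if_neg hp]
    push Not at hp
    obtain ⟨i, hi⟩ := hp
    exact Finset.prod_eq_zero (Finset.mem_univ i) (by simp [hi])

theorem binomEval_add {q n : ℕ} [NeZero q] (h : BinomGood q) (d : ℕ)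
    (c : (Fin n → ZMod q) → ZMod 2) (hc : ∀ e, d < expDeg e → c e = 0) :
    ∃ K : (Fin n → ZMod q) → (Fin n → ZMod q) → ZMod 2,
      (∀ s t, d < expDeg s + expDeg t → K s t = 0) ∧
      ∀ x y, binomEval c (x + y) = ∑ s, ∑ t, K s t * (binomProd s x * binomProd t y) := by
  refine ⟨fun s t => ∑ e, c e * (if ∀ i, (s i).val + (t i).val = (e i).val then 1 else 0),
    ?_, ?_⟩
  · intro s t hst
    refine Finset.sum_eq_zero fun e _ => ?_
    split_ifs with he
    · have : expDeg e = expDeg s + expDeg t := by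
        simp [expDeg, ← Finset.sum_add_distrib, he]
      rw [hc e (by omega)]; simp
    · simp
  · intro x y
    unfold binomEval
    simp_rw [binomProd_add h, Finset.mul_sum, Finset.sum_mul]
    rw [Finset.sum_comm]
    refine Finset.sum_congr rfl fun s _ => ?_
    rw [Finset.sum_comm]
    refine Finset.sum_congr rfl fun t _ => Finset.sum_congr rfl fun e _ => ?_
    ring

/-- In each product of monomials in P(x + y), of total degree at most 2d+1, one factor has degree at
most d. Grouping by that factor makes the diagonal matrix a sum of two matrices, each factoring
through the low monomials; a nonvanishing diagonal gives full rank. -/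
theorem card_le_of_diagonal {q n : ℕ} [NeZero q] (h : BinomGood q) (d : ℕ)
    (c : (Fin n → ZMod q) → ZMod 2) (hc : ∀ e, 2 * d + 1 < expDeg e → c e = 0)
    {ι : Type*} [Fintype ι] (α β : ι → Fin n → ZMod q)
    (hdiag : ∀ i, binomEval c (α i + β i) ≠ 0)
    (hoff : ∀ i j, i ≠ j → binomEval c (α i + β j) = 0) :
    Fintype.card ι ≤ 2 * lowCount q n d := by
  classical
  obtain ⟨K, hK, hKe⟩ := binomEval_add h _ c hc
  let low := {s : Fin n → ZMod q // expDeg s ≤ d}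
  have hlow : Fintype.card low = lowCount q n d := by
    rw [Fintype.card_subtype]; rfl
  let X : Matrix ι low (ZMod 2) := fun i s => binomProd s.1 (α i)
  let Y : Matrix low ι (ZMod 2) := fun s j => ∑ t, K s.1 t * binomProd t (β j)
  let X' : Matrix ι low (ZMod 2) := fun i t =>
    ∑ s ∈ Finset.univ.filter (fun s => ¬ expDeg s ≤ d), K s t.1 * binomProd s (α i)
  let Y' : Matrix low ι (ZMod 2) := fun t j => binomProd t.1 (β j)
  have hM : Matrix.diagonal (fun i => binomEval c (α i + β i)) = X * Y + X' * Y' := by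
    ext i j
    have e1 : (Matrix.diagonal (fun i => binomEval c (α i + β i)) : Matrix ι ι (ZMod 2)) i j
        = binomEval c (α i + β j) := by
      by_cases hij : i = j
      · subst hij; simp
      · rw [Matrix.diagonal_apply_ne _ hij, hoff i j hij]
    rw [e1, hKe, Matrix.add_apply, Matrix.mul_apply, Matrix.mul_apply]
    rw [← Finset.sum_filter_add_sum_filter_not Finset.univ (fun s => expDeg s ≤ d)]
    congr 1
    · rw [Finset.sum_subtype (p := fun s => expDeg s ≤ d) _ (by simp)]
      refine Finset.sum_congr rfl fun s _ => ?_
      simp only [X, Y, Finset.mul_sum]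
      refine Finset.sum_congr rfl fun t _ => by ring
    · rw [Finset.sum_comm]
      rw [← Finset.sum_filter_add_sum_filter_not Finset.univ (fun s => expDeg s ≤ d)]
      have : ∑ t ∈ Finset.univ.filter (fun s => ¬ expDeg s ≤ d),
          ∑ s ∈ Finset.univ.filter (fun s => ¬ expDeg s ≤ d),
            K s t * (binomProd s (α i) * binomProd t (β j)) = 0 := by
        refine Finset.sum_eq_zero fun t ht => Finset.sum_eq_zero fun s hs => ?_
        simp only [Finset.mem_filter, Finset.mem_univ, true_and] at ht hs
        rw [hK s t (by omega), zero_mul]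
      rw [this, add_zero, Finset.sum_subtype (p := fun s => expDeg s ≤ d) _ (by simp)]
      refine Finset.sum_congr rfl fun t _ => ?_
      simp only [X', Y', Finset.sum_mul]
      refine Finset.sum_congr rfl fun s _ => by ring
  have hr : (Matrix.diagonal (fun i => binomEval c (α i + β i))).rank = Fintype.card ι := by
    rw [Matrix.rank_diagonal]
    exact Fintype.card_congr (Equiv.subtypeUnivEquiv hdiag)
  rw [← hr, hM]
  calc (X * Y + X' * Y').rank = (Matrix.fromCols X X' * Matrix.fromRows Y Y').rank := by
        rw [Matrix.fromCols_mul_fromRows]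
    _ ≤ (Matrix.fromCols X X').rank := Matrix.rank_mul_le_left _ _
    _ ≤ Fintype.card (low ⊕ low) := Matrix.rank_le_card_width _
    _ = 2 * lowCount q n d := by rw [Fintype.card_sum, hlow]; ring

/-- Take an admissible function with the fewest zeros on D. If the zeros outnumbered the high-degree
conditions, some nonzero function supported on them would have low degree, and adding it would
remove a zero without creating any. -/
theorem exists_binomEval_large_support {q n : ℕ} [NeZero q] (h : BinomGood q) (d : ℕ)
    (D : Finset (Fin n → ZMod q)) :
    ∃ c : (Fin n → ZMod q) → ZMod 2, (∀ e, d < expDeg e → c e = 0) ∧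
      (∀ x, x ∉ D → binomEval c x = 0) ∧
      (D.filter fun x => binomEval c x = 0).card ≤ highCount q n d := by
  classical
  let V : Finset ((Fin n → ZMod q) → ZMod 2) := Finset.univ.filter fun c =>
    (∀ e, d < expDeg e → c e = 0) ∧ (∀ x, x ∉ D → binomEval c x = 0)
  have hV : V.Nonempty :=
    ⟨0, Finset.mem_filter.mpr ⟨Finset.mem_univ _, by simp, by simp [binomEval]⟩⟩
  obtain ⟨c, hcV, hmax⟩ := V.exists_min_image
    (fun c => (D.filter fun x => binomEval c x = 0).card) hV
  simp only [V, Finset.mem_filter, Finset.mem_univ, true_and] at hcV hmax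
  refine ⟨c, hcV.1, hcV.2, ?_⟩
  by_contra! hlt
  set Z := D.filter fun x => binomEval c x = 0 with hZ
  let high := {e : Fin n → ZMod q // d < expDeg e}
  have hhigh : Fintype.card high = highCount q n d := by
    rw [Fintype.card_subtype]; rfl
  let M : Matrix high Z (ZMod 2) := fun e x => binomProd x.1 e.1
  have hker : LinearMap.ker M.mulVecLin ≠ ⊥ := by
    apply LinearMap.ker_ne_bot_of_finrank_lt
    simp only [Module.finrank_fintype_fun_eq_card, hhigh, Fintype.card_coe]
    exact hlt
  obtain ⟨f, hf, hf0⟩ := Submodule.exists_mem_ne_zero_of_ne_bot hker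
  have hf' : ∀ e : high, ∑ x : Z, binomProd x.1 e.1 * f x = 0 := fun e =>
    congrFun (LinearMap.mem_ker.mp hf) e
  -- Coefficients, by binomial inversion, of the extension of `f` by zero off `Z`; those of high
  -- degree vanish because `f` is in the kernel.
  let g : (Fin n → ZMod q) → ZMod 2 := fun e => ∑ x : Z, binomProd x.1 e * f x
  have hg : ∀ y, binomEval g y = ∑ x : Z, if x.1 = y then f x else 0 := by
    intro y
    simp only [binomEval, g, Finset.sum_mul]
    rw [Finset.sum_comm]
    refine Finset.sum_congr rfl fun x _ => ?_
    have := binomProd_inv h x.1 y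
    calc _ = (∑ e, binomProd e y * binomProd x.1 e) * f x := by
          rw [Finset.sum_mul]; exact Finset.sum_congr rfl fun e _ => by ring
      _ = _ := by rw [this]; split_ifs <;> simp
  have hgZ : ∀ x : Z, binomEval g x = f x := by
    intro x
    rw [hg, Finset.sum_eq_single x]
    · simp
    · intro b _ hb
      rw [if_neg (fun h => hb (Subtype.ext h))]
    · simp
  have hgn : ∀ y, y ∉ Z → binomEval g y = 0 := by
    intro y hy
    rw [hg]
    refine Finset.sum_eq_zero fun x _ => ?_
    rw [if_neg]; rintro rfl; exact hy x.2
  have hadd : ∀ y, binomEval (c + g) y = binomEval c y + binomEval g y := by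
    intro y; simp [binomEval, add_mul, Finset.sum_add_distrib]
  have := hmax (c + g) ⟨fun e he => by
      rw [Pi.add_apply, hcV.1 e he, zero_add]; exact hf' ⟨e, he⟩, fun x hx => by
      rw [hadd, hcV.2 x hx, hgn x (fun h => hx (Finset.mem_filter.mp h).1), add_zero]⟩
  obtain ⟨z, hz⟩ := Function.ne_iff.mp hf0
  refine absurd this (not_le.mpr (Finset.card_lt_card ?_))
  rw [Finset.ssubset_iff_of_subset]
  · refine ⟨z.1, z.2, ?_⟩
    intro h'
    have h2 := (Finset.mem_filter.mp h').2
    rw [hadd, hgZ, (Finset.mem_filter.mp z.2).2, zero_add] at h2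
    exact hz h2
  · intro y hy
    rw [Finset.mem_filter] at hy
    refine Finset.mem_filter.mpr ⟨hy.1, ?_⟩
    by_contra hne
    have : y ∉ Z := fun h => hne (Finset.mem_filter.mp h).2
    rw [hadd, hgn y this, add_zero] at hy
    exact hne hy.2

/-! ### Progressions modulo 8 through binary digits -/

/-- Reduction mod 2 of an element of `ZMod 8`. -/
def parity (a : ZMod 8) : ZMod 2 := (a.val : ZMod 2)

/-- Reduction mod 4 of an element of `ZMod 8`. -/
def redFour (a : ZMod 8) : ZMod 4 := (a.val : ZMod 4)

/-- Half of an element of `ZMod 8`, rounded down. -/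
def halfFloor (a : ZMod 8) : ZMod 4 := ((a.val / 2 : ℕ) : ZMod 4)

/-- Half of an element of `ZMod 8`, rounded up. -/
def halfCeil (a : ZMod 8) : ZMod 4 := (((a.val + 1) / 2 : ℕ) : ZMod 4)

/-- The leading binary digit of an element of `ZMod 8`. -/
def topBit (a : ZMod 8) : ZMod 2 := ((a.val / 4 : ℕ) : ZMod 2)

/-- Reduction mod 2 of an element of `ZMod 4`. -/
def lowBit (p : ZMod 4) : ZMod 2 := (p.val : ZMod 2)

/-- The leading binary digit of an element of `ZMod 4`. -/
def midBit (p : ZMod 4) : ZMod 2 := ((p.val / 2 : ℕ) : ZMod 2)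

/-- For a, a' of equal parity, rounding one half up and the other down gives exactly (a + a')/2
modulo 4, written as a function of a plus a function of a'. -/
theorem add_eq_of_half_add : ∀ a a' b : ZMod 8, parity a = parity a' →
    halfCeil a + halfFloor a' = redFour b → a + a' = b + b := by decide

theorem halfCeil_add_halfFloor : ∀ a : ZMod 8, halfCeil a + halfFloor a = redFour a := by decide

/-- If a and a' have the same residue p modulo 4, half their sum is p + 2(top a + top a') modulo 4:
the low bit is that of p, and the top bits shift only the middle bit. -/
theorem add_eq_of_bits : ∀ a a' b : ZMod 8, redFour a = redFour a' →
    lowBit (redFour b) = lowBit (redFour a) →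
    midBit (redFour a) + topBit a + topBit a' = midBit (redFour b) → a + a' = b + b := by decide

theorem bits_add_self : ∀ x y : ZMod 2, x + y + y = x := by decide

theorem eq_of_bits_four : ∀ p p' : ZMod 4, lowBit p = lowBit p' → midBit p = midBit p' →
    p = p' := by decide

theorem eq_of_redFour_topBit : ∀ a a' : ZMod 8, redFour a = redFour a' → topBit a = topBit a' →
    a = a' := by decide

/-- In an abelian group, a set is free of non-trivial progressions when `a + c = 2 b` forces
`a = c`. -/
def AddProgressionFree {G : Type*} [AddCommGroup G] (A : Finset G) : Prop :=
  ∀ a ∈ A, ∀ b ∈ A, ∀ c ∈ A, a + c = b + b → a = c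

section
variable {n : ℕ} {A : Finset (Fin n → ZMod 8)}

/-- The set of residues mod 4 of elements of `A`. -/
def residues (A : Finset (Fin n → ZMod 8)) : Finset (Fin n → ZMod 4) :=
  A.image fun a => redFour ∘ a

/-- The elements of `A` with residue `p` mod 4. -/
def fiber (A : Finset (Fin n → ZMod 8)) (p : Fin n → ZMod 4) : Finset (Fin n → ZMod 8) :=
  A.filter fun a => redFour ∘ a = p

theorem mem_fiber {p : Fin n → ZMod 4} {a : Fin n → ZMod 8} :
    a ∈ fiber A p ↔ a ∈ A ∧ redFour ∘ a = p := Finset.mem_filter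

theorem card_coset_nonvanishing_le (hA : AddProgressionFree A) (d : ℕ)
    (c : (Fin n → ZMod 4) → ZMod 2) (hc : ∀ e, 2 * d + 1 < expDeg e → c e = 0)
    (hv : ∀ x, x ∉ residues A → binomEval c x = 0) (κ : Fin n → ZMod 2) :
    (A.filter fun a => binomEval c (redFour ∘ a) ≠ 0 ∧ parity ∘ a = κ).card ≤
      2 * lowCount 4 n d := by
  rw [← Fintype.card_coe]
  refine card_le_of_diagonal binomGood_four d c hc (fun a i => halfCeil (a.1 i))
    (fun a i => halfFloor (a.1 i)) ?_ ?_
  · rintro ⟨a, ha⟩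
    have ha := (Finset.mem_filter.mp ha).2.1
    convert ha using 2
    funext i
    exact halfCeil_add_halfFloor _
  · rintro ⟨a, ha⟩ ⟨a', ha'⟩ hne
    apply hv
    intro hmem
    obtain ⟨b, hb, hbe⟩ := Finset.mem_image.mp hmem
    have ha := Finset.mem_filter.mp ha
    have ha' := Finset.mem_filter.mp ha'
    refine hne (Subtype.ext (hA a ha.1 b hb a' ha'.1 ?_))
    funext i
    refine add_eq_of_half_add _ _ _ ?_ (congrFun hbe i).symm
    exact congrFun (ha.2.2.trans ha'.2.2.symm) i

/-- Within a class modulo 2, a residue is determined by its middle bits. Where the large-support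
function is nonzero at those bits, the diagonal bound applied to the top bits makes the fiber small,
so large fibers occur only at its zeros. -/
theorem card_large_fibers_le (hA : AddProgressionFree A) (j : ℕ) (κ : Fin n → ZMod 2) :
    ((residues A).filter fun p => 2 * lowCount 2 n j < (fiber A p).card ∧ lowBit ∘ p = κ).card ≤
      highCount 2 n (2 * j + 1) := by
  obtain ⟨c, hc, hv, hcard⟩ := exists_binomEval_large_support binomGood_two (2 * j + 1)
    (((residues A).filter fun p => lowBit ∘ p = κ).image fun p => midBit ∘ p)
  refine le_trans ?_ hcard
  refine Finset.card_le_card_of_injOn (fun p => midBit ∘ p) ?_ ?_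
  · intro p hp
    obtain ⟨hpA, hlt, hκ⟩ := Finset.mem_filter.mp hp
    refine Finset.mem_coe.mpr (Finset.mem_filter.mpr ⟨Finset.mem_image.mpr
      ⟨p, Finset.mem_filter.mpr ⟨hpA, hκ⟩, rfl⟩, ?_⟩)
    by_contra hne
    refine absurd hlt (not_lt.mpr ?_)
    rw [← Fintype.card_coe]
    refine card_le_of_diagonal binomGood_two j c hc (fun a => midBit ∘ p + topBit ∘ a.1)
      (fun a => topBit ∘ a.1) ?_ ?_
    · intro a
      convert hne using 2
      funext i
      exact bits_add_self _ _
    · rintro ⟨a, ha⟩ ⟨a', ha'⟩ hne'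
      apply hv
      intro hmem
      obtain ⟨p', hp', hpe⟩ := Finset.mem_image.mp hmem
      obtain ⟨hp'A, hκ'⟩ := Finset.mem_filter.mp hp'
      obtain ⟨b, hb, rfl⟩ := Finset.mem_image.mp hp'A
      obtain ⟨haA, hap⟩ := mem_fiber.mp ha
      obtain ⟨haA', hap'⟩ := mem_fiber.mp ha'
      refine hne' (Subtype.ext (hA a haA b hb a' haA' ?_))
      funext i
      subst hap
      refine add_eq_of_bits _ _ _ (congrFun hap'.symm i) ?_ (congrFun hpe i).symm
      exact congrFun (hκ'.trans hκ.symm) i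
  · intro p hp p' hp' he
    have h1 := (Finset.mem_filter.mp hp).2.2.trans (Finset.mem_filter.mp hp').2.2.symm
    funext i
    exact eq_of_bits_four _ _ (congrFun h1 i) (congrFun he i)

theorem card_le_mul_of_fibers {α : Type*} (s : Finset α) (f : α → Fin n → ZMod 2)
    (k : ℕ) (P : α → Prop) [DecidablePred P]
    (h : ∀ κ, (s.filter fun a => P a ∧ f a = κ).card ≤ k) :
    (s.filter P).card ≤ 2 ^ n * k := by
  have h1 := Finset.card_le_mul_card_image_of_maps_to (s := s.filter P)
    (t := (Finset.univ : Finset (Fin n → ZMod 2))) (f := f) (fun _ _ => Finset.mem_univ _) k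
    (fun κ _ => by rw [Finset.filter_filter]; exact h κ)
  have h2 : (Finset.univ : Finset (Fin n → ZMod 2)).card = 2 ^ n := by
    rw [Finset.card_univ, Fintype.card_fun, ZMod.card, Fintype.card_fin]
  rw [h2] at h1
  rwa [mul_comm]

theorem lowCount_mono {q n : ℕ} [NeZero q] : Monotone fun d => lowCount q n d := fun _ _ h =>
  Finset.card_le_card (Finset.monotone_filter_right _ fun _ _ he => le_trans he h)

theorem card_fiber_le (p : Fin n → ZMod 4) : (fiber A p).card ≤ lowCount 2 n n := by
  refine Finset.card_le_card_of_injOn (fun a => topBit ∘ a) ?_ ?_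
  · intro a _
    refine Finset.mem_coe.mpr (Finset.mem_filter.mpr ⟨Finset.mem_univ _, ?_⟩)
    calc expDeg (fun i => topBit (a i)) ≤ ∑ _i : Fin n, 1 :=
          Finset.sum_le_sum fun i _ => Nat.lt_succ_iff.mp (ZMod.val_lt (topBit (a i)))
      _ = n := by simp
  · intro a ha b hb he
    have h1 := (mem_fiber.mp ha).2.trans (mem_fiber.mp hb).2.symm
    funext i
    exact eq_of_redFour_topBit _ _ (congrFun h1 i) (congrFun he i)

/-- If m is the least index with k ≤ f m, then j = m - 1 is at least j₀ and its term alone is f m ≥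
k. -/
theorem le_sum_levels {f : ℕ → ℕ} (hf : Monotone f) {n j₀ k : ℕ} (hk : k ≤ f n)
    (hlt : f j₀ < k) : k ≤ ∑ j ∈ Finset.Ico j₀ n, if f j < k then f (j + 1) else 0 := by
  classical
  have hex : ∃ m, k ≤ f m := ⟨n, hk⟩
  have h1 := Nat.find_spec hex
  have h2 : Nat.find hex ≤ n := Nat.find_min' hex hk
  have h3 : j₀ < Nat.find hex := by
    by_contra! h
    exact absurd (h1.trans (hf h)) (not_le.mpr hlt)
  obtain ⟨j, hj⟩ := Nat.exists_eq_succ_of_ne_zero (Nat.ne_of_gt (Nat.zero_lt_of_lt h3))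
  have h4 : f j < k := not_le.mp (Nat.find_min hex (by omega))
  rw [hj] at h1 h2 h3
  calc k ≤ if f j < k then f (j + 1) else 0 := by rw [if_pos h4]; exact h1
    _ ≤ _ := Finset.single_le_sum (f := fun j => if f j < k then f (j + 1) else 0)
        (fun _ _ => Nat.zero_le _) (Finset.mem_Ico.mpr ⟨by omega, by omega⟩)

theorem AddProgressionFree.card_le (hA : AddProgressionFree A) (d j₀ : ℕ) :
    A.card ≤ 2 ^ n * (2 * lowCount 4 n d) + highCount 4 n (2 * d + 1) * (2 * lowCount 2 n j₀) +
      ∑ j ∈ Finset.Ico j₀ n, 2 ^ n * highCount 2 n (2 * j + 1) * (2 * lowCount 2 n (j + 1)) := by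
  classical
  obtain ⟨c, hc, hv, hcard⟩ := exists_binomEval_large_support binomGood_four (2 * d + 1)
    (residues A)
  rw [← Finset.card_filter_add_card_filter_not (s := A)
    (fun a => binomEval c (redFour ∘ a) ≠ 0), add_assoc]
  refine add_le_add ?_ ?_
  · exact card_le_mul_of_fibers A (fun a => parity ∘ a) _ _
      (card_coset_nonvanishing_le hA d c hc hv)
  set Z := (residues A).filter fun x => binomEval c x = 0
  have h1 : (A.filter fun a => ¬ binomEval c (redFour ∘ a) ≠ 0).card ≤
      ∑ p ∈ Z, (fiber A p).card := by
    rw [Finset.card_eq_sum_card_fiberwise (f := fun a => redFour ∘ a) (t := Z)]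
    · exact Finset.sum_le_sum fun p _ => Finset.card_le_card fun a ha => by
        simp only [Finset.mem_filter] at ha
        exact mem_fiber.mpr ⟨ha.1.1, ha.2⟩
    · intro a ha
      simp only [Finset.coe_filter, Set.mem_ofPred_eq, not_not] at ha
      exact Finset.mem_coe.mpr (Finset.mem_filter.mpr
        ⟨Finset.mem_image.mpr ⟨a, ha.1, rfl⟩, ha.2⟩)
  refine h1.trans ?_
  have hmono : Monotone fun j => 2 * lowCount 2 n j := fun _ _ h =>
    Nat.mul_le_mul_left 2 (lowCount_mono h)
  -- A layer decomposition of the fiber size. The levels stop at `n`, since a fiber has at most 2^n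
  -- elements and every exponent vector modulo 2 has degree at most `n`.
  have h2 : ∀ p, (fiber A p).card ≤ 2 * lowCount 2 n j₀ + ∑ j ∈ Finset.Ico j₀ n,
      if 2 * lowCount 2 n j < (fiber A p).card then 2 * lowCount 2 n (j + 1) else 0 := by
    intro p
    rcases le_or_gt (fiber A p).card (2 * lowCount 2 n j₀) with h | h
    · exact h.trans (Nat.le_add_right _ _)
    · have h3 : (fiber A p).card ≤ 2 * lowCount 2 n n :=
        (card_fiber_le p).trans (by omega)
      exact (le_sum_levels hmono h3 h).trans (Nat.le_add_left _ _)
  calc ∑ p ∈ Z, (fiber A p).card ≤ ∑ p ∈ Z, (2 * lowCount 2 n j₀ + ∑ j ∈ Finset.Ico j₀ n,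
      if 2 * lowCount 2 n j < (fiber A p).card then 2 * lowCount 2 n (j + 1) else 0) :=
        Finset.sum_le_sum fun p _ => h2 p
    _ = Z.card * (2 * lowCount 2 n j₀) + ∑ j ∈ Finset.Ico j₀ n,
        (Z.filter fun p => 2 * lowCount 2 n j < (fiber A p).card).card *
          (2 * lowCount 2 n (j + 1)) := by
        rw [Finset.sum_add_distrib, Finset.sum_comm]
        simp [Finset.sum_ite]
    _ ≤ _ := by
        refine add_le_add (Nat.mul_le_mul_right _ hcard) (Finset.sum_le_sum fun j _ =>
          Nat.mul_le_mul_right _ ?_)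
        refine le_trans (Finset.card_le_card (Finset.filter_subset_filter _
          (Finset.filter_subset _ _))) ?_
        exact card_le_mul_of_fibers (residues A) (fun p => lowBit ∘ p) _ _
          (card_large_fibers_le hA j)

end

/-! ### The function `H4`: minimizers, monotonicity, concavity -/

/-- The mean degree, divided by `3`, of the weights `1, x, x ^ 2, x ^ 3`. -/
noncomputable def meanDeg (x : ℝ) : ℝ :=
  (x + 2 * x ^ 2 + 3 * x ^ 3) / (3 * (1 + x + x ^ 2 + x ^ 3))

theorem weight4_pos (ρ : ℝ) {x : ℝ} (hx : 0 < x) : 0 < weight4 ρ x := by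
  unfold weight4; positivity

theorem log_weight4 (ρ : ℝ) {x : ℝ} (hx : 0 < x) :
    Real.log (weight4 ρ x) = -3 * ρ * Real.log x + Real.log (1 + x + x ^ 2 + x ^ 3) := by
  unfold weight4
  rw [Real.log_mul (by positivity) (by positivity), Real.log_rpow hx]

/-- Weighted AM-GM for the numbers (y/x)^k with weights x^k/S: their geometric mean is
(y/x)^(3·`meanDeg x`). Hence x is the exact minimizer for ρ = `meanDeg x`. -/
theorem weight4_meanDeg_le {x y : ℝ} (hx : 0 < x) (hy : 0 < y) :
    weight4 (meanDeg x) x ≤ weight4 (meanDeg x) y := by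
  set S := 1 + x + x ^ 2 + x ^ 3 with hS
  have hS0 : 0 < S := by positivity
  have h := Real.geom_mean_le_arith_mean4_weighted (w₁ := 1 / S) (w₂ := x / S) (w₃ := x ^ 2 / S)
    (w₄ := x ^ 3 / S) (p₁ := 1) (p₂ := y / x) (p₃ := (y / x) ^ 2) (p₄ := (y / x) ^ 3)
    (by positivity) (by positivity) (by positivity) (by positivity) (by positivity)
    (by positivity) (by positivity) (by positivity) (by field_simp; ring)
  have h1 : (1 : ℝ) / S * 1 + x / S * (y / x) + x ^ 2 / S * (y / x) ^ 2 +
      x ^ 3 / S * (y / x) ^ 3 = (1 + y + y ^ 2 + y ^ 3) / S := by field_simp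
  have hyx : 0 < y / x := div_pos hy hx
  have h2 : (1 : ℝ) ^ (1 / S) * (y / x) ^ (x / S) * ((y / x) ^ 2) ^ (x ^ 2 / S) *
      ((y / x) ^ 3) ^ (x ^ 3 / S) = (y / x) ^ (3 * meanDeg x) := by
    rw [Real.one_rpow, one_mul, ← Real.rpow_natCast, ← Real.rpow_natCast (y / x) 3,
      ← Real.rpow_mul hyx.le, ← Real.rpow_mul hyx.le, ← Real.rpow_add hyx, ← Real.rpow_add hyx]
    congr 1
    unfold meanDeg
    rw [← hS]
    push_cast
    field_simp
  rw [h1, h2] at h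
  have h3 : 0 < y ^ (3 * meanDeg x) := by positivity
  have h4 : 0 < x ^ (3 * meanDeg x) := by positivity
  unfold weight4
  rw [← hS, neg_mul, Real.rpow_neg hx.le, Real.rpow_neg hy.le]
  rw [Real.div_rpow hy.le hx.le, div_le_div_iff₀ h4 hS0] at h
  rw [inv_mul_eq_div, inv_mul_eq_div, div_le_div_iff₀ h4 h3]
  linarith

theorem meanDeg_le_half_iff {x : ℝ} (hx : 0 < x) : meanDeg x ≤ 1 / 2 ↔ x ≤ 1 := by
  unfold meanDeg
  rw [div_le_div_iff₀ (by positivity) (by positivity)]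
  constructor
  · intro h
    by_contra! h1
    nlinarith [mul_pos (sub_pos.mpr h1) (by positivity : 0 < 3 * x ^ 2 + 4 * x + 3)]
  · intro h
    nlinarith [mul_nonneg (sub_nonneg.mpr h) (by positivity : 0 ≤ 3 * x ^ 2 + 4 * x + 3)]

theorem exists_meanDeg_eq {ρ : ℝ} (h0 : 0 < ρ) (h1 : ρ < 1) : ∃ x, 0 < x ∧ meanDeg x = ρ := by
  have h1' : 0 < 1 - ρ := by linarith
  -- The endpoints suit the intermediate value theorem because `meanDeg x` lies between 1 - 1/x and
  -- x.
  have hle : ρ ≤ 1 / (1 - ρ) := by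
    rw [le_div_iff₀ h1']; nlinarith
  have hc : ContinuousOn meanDeg (Icc ρ (1 / (1 - ρ))) := by
    unfold meanDeg
    refine ContinuousOn.div (by fun_prop) (by fun_prop) fun x hx => ?_
    have : 0 < x := h0.trans_le hx.1
    positivity
  obtain ⟨x, hx, hxe⟩ := intermediate_value_Icc hle hc (show ρ ∈ Icc _ _ from ⟨by
    unfold meanDeg
    rw [div_le_iff₀ (by positivity)]
    nlinarith [pow_pos h0 2, pow_pos h0 3, pow_pos h0 4], by
    have hz : 0 < 1 / (1 - ρ) := by positivity
    have hρ : ρ = 1 - 1 / (1 / (1 - ρ)) := by field_simp; ring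
    generalize 1 / (1 - ρ) = z at hz hρ
    rw [hρ]
    unfold meanDeg
    rw [le_div_iff₀ (by positivity)]
    field_simp
    nlinarith [pow_pos hz 2, pow_pos hz 3, pow_pos hz 4]⟩)
  exact ⟨x, h0.trans_le hx.1, hxe⟩

theorem isLeast_weight4 {x : ℝ} (hx : 0 < x) :
    IsLeast (weight4 (meanDeg x) '' Ioi 0) (weight4 (meanDeg x) x) := by
  refine ⟨⟨x, hx, rfl⟩, ?_⟩
  rintro _ ⟨y, hy, rfl⟩
  exact weight4_meanDeg_le hx hy

theorem one_le_weight4 {ρ x : ℝ} (h0 : 0 ≤ ρ) (h1 : ρ ≤ 1) (hx : 0 < x) : 1 ≤ weight4 ρ x := by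
  unfold weight4
  rw [neg_mul, Real.rpow_neg hx.le, inv_mul_eq_div, one_le_div (by positivity)]
  rcases le_total x 1 with h | h
  · have := Real.rpow_le_one hx.le h (by linarith : 0 ≤ 3 * ρ)
    have : 0 < x + x ^ 2 + x ^ 3 := by positivity
    linarith
  · have h2 := Real.rpow_le_rpow_of_exponent_le h (by push_cast; linarith : 3 * ρ ≤ (3 : ℕ))
    rw [Real.rpow_natCast] at h2
    have : 0 < 1 + x + x ^ 2 := by positivity
    linarith

theorem two_rpow_H4 {ρ : ℝ} (h0 : 0 ≤ ρ) (h1 : ρ ≤ 1) :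
    (2 : ℝ) ^ H4 ρ = sInf (weight4 ρ '' Ioi 0) := by
  unfold H4
  refine Real.rpow_logb (by norm_num) (by norm_num) (lt_of_lt_of_le zero_lt_one ?_)
  refine le_csInf ⟨_, 1, by simp, rfl⟩ ?_
  rintro _ ⟨y, hy, rfl⟩
  exact one_le_weight4 h0 h1 hy

theorem two_rpow_H4_le {ρ y : ℝ} (h0 : 0 ≤ ρ) (h1 : ρ ≤ 1) (hy : 0 < y) :
    (2 : ℝ) ^ H4 ρ ≤ weight4 ρ y := by
  rw [two_rpow_H4 h0 h1]
  refine csInf_le ⟨1, ?_⟩ ⟨y, hy, rfl⟩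
  rintro _ ⟨y, hy, rfl⟩
  exact one_le_weight4 h0 h1 hy

theorem two_rpow_H4_meanDeg {x : ℝ} (hx : 0 < x) :
    (2 : ℝ) ^ H4 (meanDeg x) = weight4 (meanDeg x) x := by
  have h := (isLeast_weight4 hx).csInf_eq
  unfold H4
  rw [h]
  exact Real.rpow_logb (by norm_num) (by norm_num) (weight4_pos _ hx)

theorem isLeast_two_rpow_H4 {ρ : ℝ} (hρ : ρ ∈ Ioo (0 : ℝ) 1) :
    IsLeast (weight4 ρ '' Ioi 0) ((2 : ℝ) ^ H4 ρ) := by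
  obtain ⟨x, hx, rfl⟩ := exists_meanDeg_eq hρ.1 hρ.2
  rw [two_rpow_H4_meanDeg hx]
  exact isLeast_weight4 hx

theorem H4_mul_log_two_le {ρ y : ℝ} (h0 : 0 ≤ ρ) (h1 : ρ ≤ 1) (hy : 0 < y) :
    H4 ρ * Real.log 2 ≤ -3 * ρ * Real.log y + Real.log (1 + y + y ^ 2 + y ^ 3) := by
  rw [← log_weight4 ρ hy, ← Real.log_rpow two_pos]
  exact Real.log_le_log (by positivity) (two_rpow_H4_le h0 h1 hy)

theorem H4_meanDeg_mul_log_two {x : ℝ} (hx : 0 < x) :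
    H4 (meanDeg x) * Real.log 2 =
      -3 * meanDeg x * Real.log x + Real.log (1 + x + x ^ 2 + x ^ 3) := by
  rw [← log_weight4 _ hx, ← Real.log_rpow two_pos, two_rpow_H4_meanDeg hx]

/-- The minimizer x for σ < 1/2 is below 1, so at this fixed x the exponent -3ρ makes the weight
strictly increasing in ρ. The weight at x bounds `H4 ρ` above and is exact for σ. -/
theorem H4_lt_of_lt_half {ρ σ : ℝ} (h0 : 0 ≤ ρ) (h : ρ < σ) (h1 : σ < 1 / 2) :
    H4 ρ < H4 σ := by
  obtain ⟨x, hx, rfl⟩ := exists_meanDeg_eq (h0.trans_lt h) (by linarith : σ < 1)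
  have hx1 : x < 1 := by
    refine lt_of_le_of_ne ((meanDeg_le_half_iff hx).mp h1.le) ?_
    rintro rfl
    norm_num [meanDeg] at h1
  have h2 := H4_mul_log_two_le h0 (by linarith) hx
  have h3 := H4_meanDeg_mul_log_two hx
  have h4 := Real.log_neg hx hx1
  refine lt_of_mul_lt_mul_right ?_ (Real.log_pos one_lt_two).le
  rw [h3]
  refine h2.trans_lt ?_
  nlinarith

theorem H4_le_of_le_half {ρ σ : ℝ} (h0 : 0 ≤ ρ) (h : ρ < σ) (h1 : σ ≤ 1 / 2) :
    H4 ρ ≤ H4 σ := by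
  obtain ⟨x, hx, rfl⟩ := exists_meanDeg_eq (h0.trans_lt h) (by linarith : σ < 1)
  have hx1 : x ≤ 1 := (meanDeg_le_half_iff hx).mp h1
  have h2 := H4_mul_log_two_le h0 (by linarith) hx
  have h3 := H4_meanDeg_mul_log_two hx
  have h4 := Real.log_nonpos hx.le hx1
  refine le_of_mul_le_mul_right ?_ (Real.log_pos one_lt_two)
  rw [h3]
  refine h2.trans ?_
  nlinarith

theorem strictMonoOn_H4 : StrictMonoOn H4 (Icc 0 (1 / 2)) := by
  intro ρ hρ σ hσ h
  -- At σ = 1/2 the minimizer is x = 1, whose logarithm is 0, so strictness is gained below the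
  -- midpoint.
  have h1 : H4 ρ < H4 ((ρ + σ) / 2) :=
    H4_lt_of_lt_half hρ.1 (by linarith) (by linarith [hσ.2])
  exact h1.trans_le (H4_le_of_le_half (by linarith [hρ.1, hσ.1]) (by linarith) hσ.2)

/-- An infimum of functions affine in ρ, tested at the minimizer for the convex combination. -/
theorem concaveOn_H4 : ConcaveOn ℝ (Ioo 0 1) H4 := by
  refine ⟨convex_Ioo 0 1, ?_⟩
  intro ρ hρ σ hσ a b ha hb hab
  have hm := convex_Ioo (0 : ℝ) 1 hρ hσ ha hb hab
  simp only [smul_eq_mul] at hm ⊢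
  obtain ⟨x, hx, hxe⟩ := exists_meanDeg_eq hm.1 hm.2
  have h2 := H4_mul_log_two_le hρ.1.le hρ.2.le hx
  have h3 := H4_mul_log_two_le hσ.1.le hσ.2.le hx
  have h4 := H4_meanDeg_mul_log_two hx
  rw [hxe] at h4
  refine le_of_mul_le_mul_right ?_ (Real.log_pos one_lt_two)
  rw [h4]
  set s := Real.log (1 + x + x ^ 2 + x ^ 3)
  have hb' : b = 1 - a := by linarith
  have h5 := mul_le_mul_of_nonneg_left h2 ha
  have h6 := mul_le_mul_of_nonneg_left h3 hb
  have h7 : s = a * s + b * s := by rw [hb']; ring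
  linear_combination h5 + h6 - h7

theorem continuousOn_H4 : ContinuousOn H4 (Ioo 0 1) := concaveOn_H4.continuousOn isOpen_Ioo

/-! ### The entropy sum and uniqueness of the solution -/

/-- The logarithm, to base 2, of the growth rate of the two-level count. -/
noncomputable def entropySum (θ : ℝ) : ℝ := H2 θ + H2 (1 - 2 * θ)

theorem continuous_H2 : Continuous H2 := by
  unfold H2; exact Real.binEntropy_continuous.div_const _

theorem H2_mul_log_two (θ : ℝ) : H2 θ * Real.log 2 = Real.binEntropy θ :=
  div_mul_cancel₀ _ (Real.log_pos one_lt_two).ne'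

theorem strictConcaveOn_H2 : StrictConcaveOn ℝ (Icc 0 1) H2 := by
  refine ⟨convex_Icc 0 1, ?_⟩
  intro x hx y hy hxy a b ha hb hab
  have h := Real.strictConcave_binEntropy.2 hx hy hxy ha hb hab
  have hl := Real.log_pos one_lt_two
  simp only [smul_eq_mul] at h ⊢
  refine lt_of_mul_lt_mul_right ?_ hl.le
  rw [add_mul, mul_assoc, mul_assoc, H2_mul_log_two, H2_mul_log_two, H2_mul_log_two]
  exact h

theorem strictConcaveOn_entropySum : StrictConcaveOn ℝ (Icc 0 (1 / 2)) entropySum := by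
  refine ⟨convex_Icc _ _, ?_⟩
  intro x hx y hy hxy a b ha hb hab
  have h1 := strictConcaveOn_H2.2 (x := x) (y := y) ⟨hx.1, by linarith [hx.2]⟩
    ⟨hy.1, by linarith [hy.2]⟩ hxy ha hb hab
  have h2 := strictConcaveOn_H2.2 (x := 1 - 2 * x) (y := 1 - 2 * y)
    ⟨by linarith [hx.2], by linarith [hx.1]⟩
    ⟨by linarith [hy.2], by linarith [hy.1]⟩ (fun h => hxy (by linarith)) ha hb hab
  simp only [smul_eq_mul, entropySum] at h1 h2 ⊢
  have h3 : a * (1 - 2 * x) + b * (1 - 2 * y) = 1 - 2 * (a * x + b * y) := by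
    linear_combination hab
  rw [h3] at h2
  linarith

theorem isMaxPoint_iff {x₀ : ℝ} : IsMaxPoint x₀ ↔
    x₀ ∈ Icc (1 / 4 : ℝ) (1 / 2) ∧ ∀ x ∈ Icc (1 / 4 : ℝ) (1 / 2), entropySum x ≤ entropySum x₀ := by
  unfold IsMaxPoint entropySum
  rw [isMaxOn_iff]
  simp_rw [add_comm (H2 (1 - 2 * _))]

theorem exists_isMaxPoint : ∃ x₀, IsMaxPoint x₀ := by
  have hc : ContinuousOn entropySum (Icc (1 / 4) (1 / 2)) := by
    unfold entropySum
    exact (continuous_H2.add (continuous_H2.comp (by fun_prop))).continuousOn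
  obtain ⟨x, hx, hm⟩ := isCompact_Icc.exists_isMaxOn (nonempty_Icc.mpr (by norm_num)) hc
  exact ⟨x, isMaxPoint_iff.mpr ⟨hx, fun y hy => hm hy⟩⟩

/-- A strictly concave function decreases strictly to the right of its maximum point. -/
theorem strictAntiOn_entropySum {x₀ : ℝ} (h : IsMaxPoint x₀) :
    StrictAntiOn entropySum (Icc x₀ (1 / 2)) := by
  obtain ⟨hx, hm⟩ := isMaxPoint_iff.mp h
  intro a ha b hb hab
  have h0 : (0 : ℝ) ≤ x₀ := by linarith [hx.1]
  rcases eq_or_lt_of_le ha.1 with rfl | hxa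
  · refine lt_of_le_of_ne (hm b ⟨hx.1.trans hb.1, hb.2⟩) fun he => ?_
    obtain ⟨-, hsc⟩ := strictConcaveOn_entropySum
    have := hsc ⟨h0, hx.2⟩ ⟨h0.trans hb.1, hb.2⟩ hab.ne (by norm_num : (0 : ℝ) < 1 / 2)
      (by norm_num : (0 : ℝ) < 1 / 2) (by norm_num)
    simp only [smul_eq_mul] at this
    have h2 := hm (1 / 2 * x₀ + 1 / 2 * b) ⟨by linarith [hx.1], by linarith [hx.2, hb.2]⟩
    linarith
  · have h1 := hm a ⟨hx.1.trans ha.1, ha.2⟩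
    have hba : x₀ < b := hxa.trans hab
    have := strictConcaveOn_entropySum.slope_anti_adjacent ⟨h0, hx.2⟩ ⟨h0.trans hb.1, hb.2⟩
      hxa hab
    have h3 : (entropySum b - entropySum a) / (b - a) < (entropySum a - entropySum x₀) / (a - x₀) :=
      this
    have h4 : (entropySum a - entropySum x₀) / (a - x₀) ≤ 0 :=
      div_nonpos_of_nonpos_of_nonneg (by linarith) (by linarith)
    have h5 := h3.trans_le h4
    rw [div_lt_iff₀ (by linarith)] at h5
    linarith

theorem IsMaxPoint.unique {x y : ℝ} (hx : IsMaxPoint x) (hy : IsMaxPoint y) : x = y := by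
  have h1 := isMaxPoint_iff.mp hx
  have h2 := isMaxPoint_iff.mp hy
  rcases lt_trichotomy x y with h | h | h
  · have := strictAntiOn_entropySum hx ⟨le_rfl, h1.1.2⟩ ⟨h.le, h2.1.2⟩ h
    linarith [h2.2 x h1.1]
  · exact h
  · have := strictAntiOn_entropySum hy ⟨le_rfl, h2.1.2⟩ ⟨h.le, h1.1.2⟩ h
    linarith [h1.2 y h2.1]

theorem strictAntiOn_H2_one_sub : StrictAntiOn (fun θ => H2 (1 - 2 * θ)) (Icc (1 / 4) (1 / 2)) := by
  intro a ha b hb hab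
  refine lt_of_mul_lt_mul_right ?_ (Real.log_pos one_lt_two).le
  simp only [H2_mul_log_two]
  exact Real.binEntropy_strictMonoOn ⟨by linarith [hb.2], by linarith [hb.1]⟩
    ⟨by linarith [ha.2], by linarith [ha.1]⟩ (by linarith)

/-- If θ increases, the first equation makes ρ decrease. Then `H4 (1 - 2ρ)` increases while `H2 (1 -
2θ)` decreases, against the second equation. -/
theorem SolvesSystem.unique {x₀ θ ρ θ' ρ' : ℝ} (hx : IsMaxPoint x₀) (h : SolvesSystem x₀ θ ρ)
    (h' : SolvesSystem x₀ θ' ρ') : θ = θ' ∧ ρ = ρ' := by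
  have key : ∀ {θ ρ θ' ρ' : ℝ}, SolvesSystem x₀ θ ρ → SolvesSystem x₀ θ' ρ' → ¬ θ < θ' := by
    rintro θ ρ θ' ρ' ⟨h1, h2, h3, h4⟩ ⟨h1', h2', h3', h4'⟩ hlt
    have hx4 := hx.1.1
    have h5 := strictAntiOn_entropySum hx h1 h1' hlt
    unfold entropySum at h5
    rw [← h3, ← h3'] at h5
    have h6 : ρ' < ρ := (strictMonoOn_H4.lt_iff_lt ⟨by linarith [h2'.1], h2'.2⟩
      ⟨by linarith [h2.1], h2.2⟩).mp h5
    have h7 : H4 (1 - 2 * ρ) < H4 (1 - 2 * ρ') := strictMonoOn_H4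
      ⟨by linarith [h2.2], by linarith [h2.1]⟩ ⟨by linarith [h2'.2], by linarith [h2'.1]⟩
      (by linarith)
    have h8 : H2 (1 - 2 * θ') < H2 (1 - 2 * θ) := strictAntiOn_H2_one_sub
      ⟨hx4.trans h1.1, h1.2⟩ ⟨hx4.trans h1'.1, h1'.2⟩ hlt
    linarith
  have he : θ = θ' := le_antisymm (not_lt.mp (key h' h)) (not_lt.mp (key h h'))
  subst he
  obtain ⟨-, h2, h3, -⟩ := h
  obtain ⟨-, h2', h3', -⟩ := h'
  exact ⟨rfl, strictMonoOn_H4.injOn ⟨by linarith [h2.1], h2.2⟩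
    ⟨by linarith [h2'.1], h2'.2⟩ (h3.trans h3'.symm)⟩

/-! ### Exponential-moment bounds for the counts -/

theorem sum_pow_expDeg (q n : ℕ) [NeZero q] (x : ℝ) :
    ∑ e : Fin n → ZMod q, x ^ expDeg e = (∑ k : ZMod q, x ^ k.val) ^ n := by
  have h := Finset.prod_univ_sum (fun _ : Fin n => (Finset.univ : Finset (ZMod q)))
    (fun _ k => x ^ k.val)
  rw [Fintype.piFinset_univ] at h
  simp only [Finset.prod_const, Finset.card_univ, Fintype.card_fin] at h
  rw [h]
  exact Finset.sum_congr rfl fun e _ => (Finset.prod_pow_eq_pow_sum _ _ _).symm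

theorem card_mul_le_sum_pow {q n : ℕ} [NeZero q] {x C : ℝ} (hx : 0 < x)
    (s : Finset (Fin n → ZMod q)) (h : ∀ e ∈ s, C ≤ x ^ expDeg e) :
    s.card * C ≤ (∑ k : ZMod q, x ^ k.val) ^ n := by
  rw [← sum_pow_expDeg, ← nsmul_eq_mul]
  refine (Finset.card_nsmul_le_sum s _ C h).trans ?_
  exact Finset.sum_le_sum_of_subset_of_nonneg (Finset.subset_univ _) fun _ _ _ => by positivity

theorem lowCount_le {q n d : ℕ} [NeZero q] {x τ : ℝ} (hx : 0 < x) (hx1 : x ≤ 1)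
    (hd : (d : ℝ) ≤ τ * n) :
    (lowCount q n d : ℝ) ≤ (x ^ (-τ) * ∑ k : ZMod q, x ^ k.val) ^ n := by
  have h := card_mul_le_sum_pow (C := x ^ (τ * n)) hx
    (Finset.univ.filter fun e : Fin n → ZMod q => expDeg e ≤ d) fun e he => by
      rw [← Real.rpow_natCast]
      refine Real.rpow_le_rpow_of_exponent_ge hx hx1 (le_trans ?_ hd)
      exact_mod_cast (Finset.mem_filter.mp he).2
  have hp : 0 < x ^ (τ * n) := by positivity
  rw [mul_pow, ← Real.rpow_natCast (x ^ (-τ)), ← Real.rpow_mul hx.le, neg_mul,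
    Real.rpow_neg hx.le, inv_mul_eq_div, le_div_iff₀ hp]
  exact h

theorem highCount_le {q n d : ℕ} [NeZero q] {x τ : ℝ} (hx : 0 < x) (hx1 : x ≤ 1)
    (hd : τ * n ≤ d + 1) :
    (highCount q n d : ℝ) ≤ (x ^ τ * ∑ k : ZMod q, (1 / x) ^ k.val) ^ n := by
  have h := card_mul_le_sum_pow (C := (1 / x) ^ (τ * n)) (one_div_pos.mpr hx)
    (Finset.univ.filter fun e : Fin n → ZMod q => d < expDeg e) fun e he => by
      rw [← Real.rpow_natCast]
      refine Real.rpow_le_rpow_of_exponent_le ((one_le_div hx).mpr hx1) (hd.trans ?_)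
      exact_mod_cast (Finset.mem_filter.mp he).2
  rw [one_div, Real.inv_rpow hx.le] at h
  have hp : 0 < x ^ (τ * n) := by positivity
  rw [mul_pow, ← Real.rpow_natCast (x ^ τ), ← Real.rpow_mul hx.le, mul_comm, one_div]
  rwa [← div_eq_mul_inv, div_le_iff₀ hp] at h

theorem sum_pow_two (x : ℝ) : ∑ k : ZMod 2, x ^ k.val = 1 + x := by
  change ∑ k : Fin 2, x ^ k.val = _
  simp [Fin.sum_univ_succ]

theorem sum_pow_four (x : ℝ) : ∑ k : ZMod 4, x ^ k.val = 1 + x + x ^ 2 + x ^ 3 := by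
  change ∑ k : Fin 4, x ^ k.val = _
  simp [Fin.sum_univ_succ]
  ring

theorem lowCount_four_le {n d : ℕ} {ρ : ℝ} (h0 : 0 < ρ) (h1 : ρ ≤ 1 / 2)
    (hd : (d : ℝ) ≤ 3 * ρ * n) : (lowCount 4 n d : ℝ) ≤ ((2 : ℝ) ^ H4 ρ) ^ n := by
  obtain ⟨x, hx, rfl⟩ := exists_meanDeg_eq h0 (by linarith)
  have h := lowCount_le (q := 4) hx ((meanDeg_le_half_iff hx).mp h1) hd
  rwa [sum_pow_four, ← neg_mul, ← weight4, ← two_rpow_H4_meanDeg hx] at h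

theorem highCount_four_le {n d : ℕ} {ρ : ℝ} (h0 : 0 < ρ) (h1 : ρ ≤ 1 / 2)
    (hd : 3 * (1 - ρ) * n ≤ (d : ℝ) + 1) : (highCount 4 n d : ℝ) ≤ ((2 : ℝ) ^ H4 ρ) ^ n := by
  obtain ⟨x, hx, rfl⟩ := exists_meanDeg_eq h0 (by linarith)
  have h := highCount_le (q := 4) hx ((meanDeg_le_half_iff hx).mp h1) hd
  rw [sum_pow_four] at h
  convert h using 2
  -- The reflection k ↦ 3 - k of degrees turns the weight at 1/x into the weight at x.
  rw [two_rpow_H4_meanDeg hx, weight4,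
    show 3 * (1 - meanDeg x) = -3 * meanDeg x + (3 : ℕ) by push_cast; ring, Real.rpow_add hx,
    Real.rpow_natCast]
  field_simp
  ring

theorem two_rpow_H2 {θ : ℝ} (h0 : 0 < θ) (h1 : θ < 1) :
    (2 : ℝ) ^ H2 θ = (θ / (1 - θ)) ^ (-θ) * (1 + θ / (1 - θ)) := by
  have h1' : 0 < 1 - θ := by linarith
  have hy : 0 < θ / (1 - θ) := div_pos h0 h1'
  refine Real.log_injOn_pos (mem_Ioi.mpr (by positivity)) (mem_Ioi.mpr (by positivity)) ?_
  rw [Real.log_rpow two_pos, H2_mul_log_two, Real.log_mul (by positivity) (by positivity),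
    Real.log_rpow hy, show 1 + θ / (1 - θ) = (1 - θ)⁻¹ by field_simp; ring, Real.log_inv,
    Real.log_div h0.ne' h1'.ne', Real.binEntropy_eq_negMulLog_add_negMulLog_one_sub,
    Real.negMulLog, Real.negMulLog]
  ring

theorem lowCount_two_le {n d : ℕ} {θ : ℝ} (h0 : 0 < θ) (h1 : θ ≤ 1 / 2)
    (hd : (d : ℝ) ≤ θ * n) : (lowCount 2 n d : ℝ) ≤ ((2 : ℝ) ^ H2 θ) ^ n := by
  have h1' : 0 < 1 - θ := by linarith
  have h := lowCount_le (q := 2) (div_pos h0 h1') ((div_le_one h1').mpr (by linarith)) hd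
  rwa [sum_pow_two, ← two_rpow_H2 h0 (by linarith)] at h

/-- The parameters y, z are optimal for θ and are kept for every level τ = (j+1)/n ≥ θ. The bound
depends on τ only through (z²/y)^τ, which is nonincreasing since z² ≤ y for θ ≥ 1/3. -/
theorem lowCount_mul_highCount_two_le {n j : ℕ} {θ : ℝ} (h0 : 1 / 3 ≤ θ) (h1 : θ < 1 / 2)
    (hn : 0 < n) (hj : θ * n ≤ j + 1) :
    (lowCount 2 n (j + 1) : ℝ) * highCount 2 n (2 * j + 1) ≤ ((2 : ℝ) ^ entropySum θ) ^ n := by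
  have hn' : (0 : ℝ) < n := by exact_mod_cast hn
  have h1' : 0 < 1 - θ := by linarith
  have h2' : 0 < 1 - 2 * θ := by linarith
  set y := θ / (1 - θ) with hy
  set z := (1 - 2 * θ) / (1 - (1 - 2 * θ)) with hz
  have hy0 : 0 < y := div_pos (by linarith) h1'
  have hz0 : 0 < z := div_pos h2' (by linarith)
  have hy1 : y ≤ 1 := (div_le_one h1').mpr (by linarith)
  have hz1 : z ≤ 1 := (div_le_one (by linarith)).mpr (by linarith)
  have hzy : z ^ 2 / y ≤ 1 := by
    rw [div_le_one hy0, hy, hz, div_pow, div_le_div_iff₀ (by nlinarith) h1']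
    nlinarith [mul_nonneg (sub_nonneg.mpr h0) h2'.le, mul_nonneg (sub_nonneg.mpr h0) h1'.le,
      mul_nonneg (mul_nonneg (sub_nonneg.mpr h0) h2'.le) h1'.le,
      mul_nonneg (mul_nonneg (sub_nonneg.mpr h0) h2'.le) h2'.le]
  set τ : ℝ := (j + 1) / n with hτ
  have hτn : τ * n = j + 1 := by rw [hτ]; field_simp
  have hθτ : θ ≤ τ := by rw [hτ, le_div_iff₀ hn']; exact hj
  have ha := lowCount_le (q := 2) (n := n) (d := j + 1) (τ := τ) hy0 hy1
    (by rw [hτn]; push_cast; exact le_rfl)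
  have hb := highCount_le (q := 2) (n := n) (d := 2 * j + 1) (τ := 2 * τ) hz0 hz1
    (by rw [mul_assoc, hτn]; push_cast; linarith)
  rw [sum_pow_two] at ha hb
  refine (mul_le_mul ha hb (Nat.cast_nonneg _) (by positivity)).trans ?_
  rw [← mul_pow]
  refine pow_le_pow_left₀ (by positivity) ?_ n
  have e1 : ∀ t : ℝ, y ^ (-t) * z ^ (2 * t) = (z ^ 2 / y) ^ t := by
    intro t
    rw [Real.div_rpow (by positivity) hy0.le, Real.rpow_neg hy0.le, Real.rpow_mul hz0.le,
      Real.rpow_ofNat, inv_mul_eq_div]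
  have e2 : (2 : ℝ) ^ entropySum θ = (y ^ (-θ) * z ^ (2 * θ)) * ((1 + y) * (1 + 1 / z)) := by
    rw [entropySum, Real.rpow_add two_pos, two_rpow_H2 (by linarith) (by linarith),
      two_rpow_H2 h2' (by linarith), ← hy, ← hz, neg_sub,
      show 2 * θ - 1 = 2 * θ + (-1) by ring, Real.rpow_add hz0, Real.rpow_neg_one]
    field_simp
    ring
  rw [e2, e1]
  calc y ^ (-τ) * (1 + y) * (z ^ (2 * τ) * (1 + 1 / z))
      = (y ^ (-τ) * z ^ (2 * τ)) * ((1 + y) * (1 + 1 / z)) := by ring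
    _ ≤ _ := by
      rw [e1]
      refine mul_le_mul_of_nonneg_right ?_ (by positivity)
      exact Real.rpow_le_rpow_of_exponent_ge (by positivity) hzy hθτ

theorem AddProgressionFree.card_le_poly_mul {n : ℕ} {A : Finset (Fin n → ZMod 8)}
    (hA : AddProgressionFree A) {θ ρ : ℝ} (hθ : 1 / 3 ≤ θ) (hθ' : θ < 1 / 2) (hρ : 1 / 4 ≤ ρ)
    (hρ' : ρ < 1 / 2) (h1 : H4 ρ = H2 θ + H2 (1 - 2 * θ))
    (h2 : H4 (1 - 2 * ρ) = 1 + H2 (1 - 2 * θ)) :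
    (A.card : ℝ) ≤ (2 * n + 4) * (2 * (2 : ℝ) ^ H4 ρ) ^ n := by
  set M : ℝ := (2 : ℝ) ^ H4 ρ with hM
  have hM0 : 0 < M := by positivity
  -- The cutoffs at which both equations of the system apply: `t2` uses 2d + 2 ≥ 6ρn, and every
  -- level j ≥ j₀ has j + 1 ≥ θn.
  have h := hA.card_le ⌊3 * ρ * n⌋₊ ⌊θ * n⌋₊
  have h' : (A.card : ℝ) ≤ _ := Nat.cast_le.mpr h
  push_cast at h'
  have t1 : (lowCount 4 n ⌊3 * ρ * n⌋₊ : ℝ) ≤ M ^ n :=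
    lowCount_four_le (by linarith) hρ'.le (Nat.floor_le (by positivity))
  have t2 : (highCount 4 n (2 * ⌊3 * ρ * n⌋₊ + 1) : ℝ) ≤ ((2 : ℝ) ^ H4 (1 - 2 * ρ)) ^ n := by
    refine highCount_four_le (by linarith) (by linarith) ?_
    have := Nat.lt_floor_add_one (3 * ρ * n)
    push_cast
    linarith
  have t3 : (lowCount 2 n ⌊θ * n⌋₊ : ℝ) ≤ ((2 : ℝ) ^ H2 θ) ^ n :=
    lowCount_two_le (by linarith) hθ'.le (Nat.floor_le (by positivity))
  have e : (2 : ℝ) ^ H4 (1 - 2 * ρ) * (2 : ℝ) ^ H2 θ = 2 * M := by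
    rw [hM, ← Real.rpow_add two_pos, h2, h1, show 1 + H2 (1 - 2 * θ) + H2 θ =
      1 + (H2 θ + H2 (1 - 2 * θ)) by ring, Real.rpow_add two_pos, Real.rpow_one]
  have t4 : ∀ j ∈ Finset.Ico ⌊θ * n⌋₊ n, (2 : ℝ) ^ n * highCount 2 n (2 * j + 1) *
      (2 * lowCount 2 n (j + 1)) ≤ 2 * (2 * M) ^ n := by
    intro j hj
    rw [Finset.mem_Ico] at hj
    have := Nat.lt_floor_add_one (θ * n)
    have hj1 : ((⌊θ * n⌋₊ : ℕ) : ℝ) ≤ j := by exact_mod_cast hj.1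
    have := lowCount_mul_highCount_two_le (j := j) hθ hθ' (by omega : 0 < n) (by linarith)
    rw [entropySum, ← h1, ← hM] at this
    rw [mul_pow]
    have h2n : (0 : ℝ) < 2 * 2 ^ n := by positivity
    have := mul_le_mul_of_nonneg_left this h2n.le
    linarith
  have t5 := (Finset.sum_le_card_nsmul _ _ _ t4)
  have hc : ((Finset.Ico ⌊θ * n⌋₊ n).card : ℝ) ≤ n := by
    rw [Nat.card_Ico]; exact_mod_cast Nat.sub_le _ _
  have hP : 0 < (2 * M) ^ n := by positivity
  rw [nsmul_eq_mul] at t5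
  have t6 : ((Finset.Ico ⌊θ * n⌋₊ n).card : ℝ) * (2 * (2 * M) ^ n) ≤ n * (2 * (2 * M) ^ n) :=
    mul_le_mul_of_nonneg_right hc (by positivity)
  have t7 : (2 : ℝ) ^ n * (2 * lowCount 4 n ⌊3 * ρ * n⌋₊) ≤ 2 * (2 * M) ^ n := by
    rw [mul_pow]
    have := mul_le_mul_of_nonneg_left t1 (by positivity : (0 : ℝ) ≤ 2 * 2 ^ n)
    linarith
  have t8 : (highCount 4 n (2 * ⌊3 * ρ * n⌋₊ + 1) : ℝ) * (2 * lowCount 2 n ⌊θ * n⌋₊) ≤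
      2 * (2 * M) ^ n := by
    have := mul_le_mul t2 t3 (Nat.cast_nonneg _) (by positivity)
    rw [← mul_pow, e] at this
    linarith
  linarith

/-! ### Removing the polynomial factor by taking powers -/

/-- By cancellation, a = b or b = c already forces a = c, so only the distinctness of a and c
matters. -/
theorem progressionFree_iff_add {n : ℕ} (A : Finset (C8pow n)) :
    ProgressionFree (A : Set (C8pow n)) ↔
      ∀ a ∈ A, ∀ b ∈ A, ∀ c ∈ A, a * c = b ^ 2 → a = c := by
  constructor
  · intro h a ha b hb c hc he
    by_contra hac
    refine h a ha b hb c hc ⟨?_, ?_, hac, he⟩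
    · rintro rfl
      rw [pow_two] at he
      exact hac (mul_left_cancel he).symm
    · rintro rfl
      rw [pow_two] at he
      exact hac (mul_right_cancel he)
  · intro h a ha b hb c hc ⟨_, _, hac, he⟩
    exact hac (h a ha b hb c hc he)

/-- Concatenation of `k` elements of `C_8 ^ n`, in additive notation. -/
def concat {n k : ℕ} (f : Fin k → C8pow n) (i : Fin (n * k)) : ZMod 8 :=
  (f (finProdFinEquiv.symm i).2 (finProdFinEquiv.symm i).1).toAdd

theorem concat_apply {n k : ℕ} (f : Fin k → C8pow n) (i : Fin n) (j : Fin k) :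
    concat f (finProdFinEquiv (i, j)) = (f j i).toAdd := by
  simp [concat]

theorem concat_injective (n k : ℕ) :
    Function.Injective (concat : (Fin k → C8pow n) → Fin (n * k) → ZMod 8) := by
  intro f g h
  funext j i
  have := congrFun h (finProdFinEquiv (i, j))
  rw [concat_apply, concat_apply] at this
  exact Multiplicative.toAdd.injective this

/-- The `k`-th power of a subset of `C_8 ^ n`, in additive notation. -/
def addPower {n : ℕ} (A : Finset (C8pow n)) (k : ℕ) : Finset (Fin (n * k) → ZMod 8) :=
  (Fintype.piFinset fun _ : Fin k => A).map ⟨concat, concat_injective n k⟩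

theorem card_addPower {n : ℕ} (A : Finset (C8pow n)) (k : ℕ) :
    (addPower A k).card = A.card ^ k := by
  simp [addPower]

theorem addProgressionFree_addPower {n : ℕ} {A : Finset (C8pow n)}
    (hA : ProgressionFree (A : Set (C8pow n))) (k : ℕ) : AddProgressionFree (addPower A k) := by
  rw [progressionFree_iff_add] at hA
  intro a ha b hb c hc he
  obtain ⟨f, hf, rfl⟩ := Finset.mem_map.mp ha
  obtain ⟨g, hg, rfl⟩ := Finset.mem_map.mp hb
  obtain ⟨h, hh, rfl⟩ := Finset.mem_map.mp hc
  rw [Fintype.mem_piFinset] at hf hg hh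
  have : f = h := by
    funext j
    refine hA _ (hf j) _ (hg j) _ (hh j) ?_
    funext i
    have := congrFun he (finProdFinEquiv (i, j))
    change concat f _ + concat h _ = concat g _ + concat g _ at this
    simp only [concat_apply] at this
    rw [pow_two]
    exact Multiplicative.toAdd.injective this
  rw [this]

theorem le_of_pow_le_poly_mul_pow {a b α β : ℝ} (ha : 0 ≤ a) (hb : 0 < b)
    (h : ∀ k : ℕ, a ^ k ≤ (α * k + β) * b ^ k) : a ≤ b := by
  by_contra! hlt
  have hr : 1 < a / b := (one_lt_div hb).mpr hlt
  have h1 : ∀ k : ℕ, 1 ≤ α * (k * (b / a) ^ k) + β * (b / a) ^ k := by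
    intro k
    have ha' : 0 < a := hb.trans hlt
    have hk : 0 < a ^ k := by positivity
    have := h k
    rw [div_pow]
    calc (1 : ℝ) = a ^ k / a ^ k := (div_self hk.ne').symm
      _ ≤ ((α * k + β) * b ^ k) / a ^ k := by gcongr
      _ = _ := by ring
  have hba : b / a < 1 := (div_lt_one (hb.trans hlt)).mpr hlt
  have hba0 : 0 ≤ b / a := by positivity
  have l1 := tendsto_self_mul_const_pow_of_lt_one hba0 hba
  have l2 := tendsto_pow_atTop_nhds_zero_of_lt_one hba0 hba
  have l3 := (l1.const_mul α).add (l2.const_mul β)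
  have := ge_of_tendsto' l3 h1
  norm_num at this

theorem ProgressionFree.card_le_pow {n : ℕ} {A : Finset (C8pow n)}
    (hA : ProgressionFree (A : Set (C8pow n))) {θ ρ : ℝ} (hθ : 1 / 3 ≤ θ) (hθ' : θ < 1 / 2)
    (hρ : 1 / 4 ≤ ρ) (hρ' : ρ < 1 / 2) (h1 : H4 ρ = H2 θ + H2 (1 - 2 * θ))
    (h2 : H4 (1 - 2 * ρ) = 1 + H2 (1 - 2 * θ)) :
    (A.card : ℝ) ≤ (2 * (2 : ℝ) ^ H4 ρ) ^ n := by
  refine le_of_pow_le_poly_mul_pow (α := 2 * n) (β := 4) (Nat.cast_nonneg _) (by positivity)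
    fun k => ?_
  have := (addProgressionFree_addPower hA k).card_le_poly_mul hθ hθ' hρ hρ' h1 h2
  rw [card_addPower, pow_mul] at this
  push_cast at this
  linarith

/-! ### Certified numerical values of logarithms -/

/-- Partial sums of the series log t = 2 artanh((t-1)/(t+1)) with a geometric bound on the
remainder. Below, arguments are scaled by powers of two, and inverted if need be, to bring t close
to 1. -/
theorem log_bounds {t : ℝ} (ht : 1 ≤ t) (m : ℕ) :
    2 * ∑ i ∈ Finset.range m, ((t - 1) / (t + 1)) ^ (2 * i + 1) / (2 * i + 1) ≤ Real.log t ∧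
    Real.log t ≤ 2 * ∑ i ∈ Finset.range m, ((t - 1) / (t + 1)) ^ (2 * i + 1) / (2 * i + 1) +
      2 * (((t - 1) / (t + 1)) ^ (2 * m + 1) / (1 - ((t - 1) / (t + 1)) ^ 2)) := by
  have h0 : 0 ≤ (t - 1) / (t + 1) := div_nonneg (by linarith) (by linarith)
  have h1 : (t - 1) / (t + 1) < 1 := (div_lt_one (by linarith)).mpr (by linarith)
  have e : (1 + (t - 1) / (t + 1)) / (1 - (t - 1) / (t + 1)) = t := by
    have : t + 1 ≠ 0 := by linarith
    field_simp
    ring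
  have l := Real.sum_range_le_log_div h0 h1 m
  have u := Real.log_div_le_sum_range_add h0 h1 m
  rw [e] at l u
  constructor <;> linarith

theorem log_upperPoint_bounds :
    -0.458816443 < Real.log (809 / 1280 : ℝ) ∧
      Real.log (809 / 1280 : ℝ) < -0.458816437 := by
  have h := log_bounds (t := 809 / 640) (by norm_num) 5
  have e : Real.log (809 / 1280 : ℝ) =
      Real.log (809 / 640) + -1 * Real.log 2 := by
    rw [show (809 / 1280 : ℝ) = (809 / 640) * 2 ^ (-1 : ℤ) by norm_num,
      Real.log_mul (by norm_num) (by norm_num), Real.log_zpow]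
    norm_num
  norm_num [Finset.sum_range_succ] at h
  rw [e]
  constructor <;> linarith [h.1, h.2, Real.log_two_gt_d9, Real.log_two_lt_d9]

theorem log_upperPoint_sum_bounds :
    0.825914351 < Real.log (4789828409 / 2097152000 : ℝ) ∧
      Real.log (4789828409 / 2097152000 : ℝ) < 0.825914357 := by
  have h := log_bounds (t := 4789828409 / 4194304000) (by norm_num) 4
  have e : Real.log (4789828409 / 2097152000 : ℝ) =
      Real.log (4789828409 / 4194304000) + 1 * Real.log 2 := by
    rw [show (4789828409 / 2097152000 : ℝ) = (4789828409 / 4194304000) * 2 ^ (1 : ℤ) by norm_num,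
      Real.log_mul (by norm_num) (by norm_num), Real.log_zpow]
    norm_num
  norm_num [Finset.sum_range_succ] at h
  rw [e]
  constructor <;> linarith [h.1, h.2, Real.log_two_gt_d9, Real.log_two_lt_d9]

theorem log_lowerPoint_bounds :
    -0.344048033 < Real.log (263 / 371 : ℝ) ∧
      Real.log (263 / 371 : ℝ) < -0.344048027 := by
  have h := log_bounds (t := 371 / 263) (by norm_num) 6
  have e : Real.log (263 / 371 : ℝ) =
      -Real.log (371 / 263) + 0 * Real.log 2 := by
    rw [show (263 / 371 : ℝ) = (371 / 263)⁻¹ * 2 ^ (0 : ℤ) by norm_num,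
      Real.log_mul (by norm_num) (by norm_num), Real.log_inv, Real.log_zpow]
    norm_num
  norm_num [Finset.sum_range_succ] at h
  rw [e]
  constructor <;> linarith [h.1, h.2, Real.log_two_gt_d9, Real.log_two_lt_d9]

theorem log_lowerPoint_sum_bounds :
    0.942998540 < Real.log (131117540 / 51064811 : ℝ) ∧
      Real.log (131117540 / 51064811 : ℝ) < 0.942998546 := by
  have h := log_bounds (t := 65558770 / 51064811) (by norm_num) 5
  have e : Real.log (131117540 / 51064811 : ℝ) =
      Real.log (65558770 / 51064811) + 1 * Real.log 2 := by
    rw [show (131117540 / 51064811 : ℝ) = (65558770 / 51064811) * 2 ^ (1 : ℤ) by norm_num,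
      Real.log_mul (by norm_num) (by norm_num), Real.log_zpow]
    norm_num
  norm_num [Finset.sum_range_succ] at h
  rw [e]
  constructor <;> linarith [h.1, h.2, Real.log_two_gt_d9, Real.log_two_lt_d9]

theorem log_auxPoint_bounds :
    -0.458835642 < Real.log (529 / 837 : ℝ) ∧
      Real.log (529 / 837 : ℝ) < -0.458835636 := by
  have h := log_bounds (t := 1058 / 837) (by norm_num) 5
  have e : Real.log (529 / 837 : ℝ) =
      Real.log (1058 / 837) + -1 * Real.log 2 := by
    rw [show (529 / 837 : ℝ) = (1058 / 837) * 2 ^ (-1 : ℤ) by norm_num,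
      Real.log_mul (by norm_num) (by norm_num), Real.log_zpow]
    norm_num
  norm_num [Finset.sum_range_succ] at h
  rw [e]
  constructor <;> linarith [h.1, h.2, Real.log_two_gt_d9, Real.log_two_lt_d9]

theorem log_auxPoint_sum_bounds :
    0.825895956 < Real.log (1339240060 / 586376253 : ℝ) ∧
      Real.log (1339240060 / 586376253 : ℝ) < 0.825895962 := by
  have h := log_bounds (t := 669620030 / 586376253) (by norm_num) 4
  have e : Real.log (1339240060 / 586376253 : ℝ) =
      Real.log (669620030 / 586376253) + 1 * Real.log 2 := by
    rw [show (1339240060 / 586376253 : ℝ) = (669620030 / 586376253) * 2 ^ (1 : ℤ) by norm_num,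
      Real.log_mul (by norm_num) (by norm_num), Real.log_zpow]
    norm_num
  norm_num [Finset.sum_range_succ] at h
  rw [e]
  constructor <;> linarith [h.1, h.2, Real.log_two_gt_d9, Real.log_two_lt_d9]

theorem log_angle_bounds :
    -1.070849495 < Real.log (280 / 817 : ℝ) ∧
      Real.log (280 / 817 : ℝ) < -1.070849489 := by
  have h := log_bounds (t := 817 / 560) (by norm_num) 7
  have e : Real.log (280 / 817 : ℝ) =
      -Real.log (817 / 560) + -1 * Real.log 2 := by
    rw [show (280 / 817 : ℝ) = (817 / 560)⁻¹ * 2 ^ (-1 : ℤ) by norm_num,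
      Real.log_mul (by norm_num) (by norm_num), Real.log_inv, Real.log_zpow]
    norm_num
  norm_num [Finset.sum_range_succ] at h
  rw [e]
  constructor <;> linarith [h.1, h.2, Real.log_two_gt_d9, Real.log_two_lt_d9]

theorem log_one_sub_angle_bounds :
    -0.419641003 < Real.log (537 / 817 : ℝ) ∧
      Real.log (537 / 817 : ℝ) < -0.419640997 := by
  have h := log_bounds (t := 1074 / 817) (by norm_num) 6
  have e : Real.log (537 / 817 : ℝ) =
      Real.log (1074 / 817) + -1 * Real.log 2 := by
    rw [show (537 / 817 : ℝ) = (1074 / 817) * 2 ^ (-1 : ℤ) by norm_num,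
      Real.log_mul (by norm_num) (by norm_num), Real.log_zpow]
    norm_num
  norm_num [Finset.sum_range_succ] at h
  rw [e]
  constructor <;> linarith [h.1, h.2, Real.log_two_gt_d9, Real.log_two_lt_d9]

theorem log_one_sub_two_mul_angle_bounds :
    -1.156563013 < Real.log (257 / 817 : ℝ) ∧
      Real.log (257 / 817 : ℝ) < -1.156563007 := by
  have h := log_bounds (t := 1028 / 817) (by norm_num) 5
  have e : Real.log (257 / 817 : ℝ) =
      Real.log (1028 / 817) + -2 * Real.log 2 := by
    rw [show (257 / 817 : ℝ) = (1028 / 817) * 2 ^ (-2 : ℤ) by norm_num,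
      Real.log_mul (by norm_num) (by norm_num), Real.log_zpow]
    norm_num
  norm_num [Finset.sum_range_succ] at h
  rw [e]
  constructor <;> linarith [h.1, h.2, Real.log_two_gt_d9, Real.log_two_lt_d9]

theorem log_upperValue_bounds :
    1.265531105 < Real.log (141799 / 40000 : ℝ) ∧
      Real.log (141799 / 40000 : ℝ) < 1.265531111 := by
  have h := log_bounds (t := 160000 / 141799) (by norm_num) 4
  have e : Real.log (141799 / 40000 : ℝ) =
      -Real.log (160000 / 141799) + 2 * Real.log 2 := by
    rw [show (141799 / 40000 : ℝ) = (160000 / 141799)⁻¹ * 2 ^ (2 : ℤ) by norm_num,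
      Real.log_mul (by norm_num) (by norm_num), Real.log_inv, Real.log_zpow]
    norm_num
  norm_num [Finset.sum_range_succ] at h
  rw [e]
  constructor <;> linarith [h.1, h.2, Real.log_two_gt_d9, Real.log_two_lt_d9]

theorem log_lowerValue_bounds :
    1.265517000 < Real.log (141797 / 40000 : ℝ) ∧
      Real.log (141797 / 40000 : ℝ) < 1.265517006 := by
  have h := log_bounds (t := 160000 / 141797) (by norm_num) 4
  have e : Real.log (141797 / 40000 : ℝ) =
      -Real.log (160000 / 141797) + 2 * Real.log 2 := by
    rw [show (141797 / 40000 : ℝ) = (160000 / 141797)⁻¹ * 2 ^ (2 : ℤ) by norm_num,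
      Real.log_mul (by norm_num) (by norm_num), Real.log_inv, Real.log_zpow]
    norm_num
  norm_num [Finset.sum_range_succ] at h
  rw [e]
  constructor <;> linarith [h.1, h.2, Real.log_two_gt_d9, Real.log_two_lt_d9]

theorem log_three_halves_bounds :
    0.405465105 < Real.log (3 / 2 : ℝ) ∧
      Real.log (3 / 2 : ℝ) < 0.405465111 := by
  have h := log_bounds (t := 3 / 2) (by norm_num) 7
  have e : Real.log (3 / 2 : ℝ) =
      Real.log (3 / 2) + 0 * Real.log 2 := by
    rw [show (3 / 2 : ℝ) = (3 / 2) * 2 ^ (0 : ℤ) by norm_num,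
      Real.log_mul (by norm_num) (by norm_num), Real.log_zpow]
    norm_num
  norm_num [Finset.sum_range_succ] at h
  rw [e]
  constructor <;> linarith [h.1, h.2, Real.log_two_gt_d9, Real.log_two_lt_d9]

/-! ### Entropy inequalities at rational points -/

theorem meanDeg_upperPoint : meanDeg (809 / 1280) = 1529787449 / 4789828409 := by
  norm_num [meanDeg]

theorem meanDeg_lowerPoint : meanDeg (263 / 371) = 1 - 2 * (41875883 / 131117540) := by
  norm_num [meanDeg]

theorem meanDeg_auxPoint : meanDeg (529 / 837) = 213860417 / 669620030 := by
  norm_num [meanDeg]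

theorem binEntropy_angle : Real.binEntropy (280 / 817) =
    -(280 / 817) * Real.log (280 / 817) - 537 / 817 * Real.log (537 / 817) := by
  rw [Real.binEntropy_eq_negMulLog_add_negMulLog_one_sub, Real.negMulLog, Real.negMulLog]
  norm_num
  ring

theorem binEntropy_one_sub_two_mul_angle : Real.binEntropy (1 - 2 * (280 / 817)) =
    -(257 / 817) * Real.log (257 / 817) -
      560 / 817 * (Real.log 2 + Real.log (280 / 817)) := by
  rw [← Real.log_mul (by norm_num) (by norm_num),
    Real.binEntropy_eq_negMulLog_add_negMulLog_one_sub, Real.negMulLog, Real.negMulLog]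
  norm_num
  ring

theorem binEntropy_third : Real.binEntropy (1 - 2 * (1 / 3)) =
    1 / 3 * Real.log 2 + Real.log (3 / 2) := by
  have h1 : Real.log (1 / 3) = -(Real.log (3 / 2) + Real.log 2) := by
    rw [← Real.log_mul (by norm_num) (by norm_num), ← Real.log_inv]
    norm_num
  have h2 : Real.log (2 / 3) = -Real.log (3 / 2) := by
    rw [← Real.log_inv]
    norm_num
  rw [Real.binEntropy_eq_negMulLog_add_negMulLog_one_sub, Real.negMulLog, Real.negMulLog,
    show (1 - 2 * (1 / 3) : ℝ) = 1 / 3 by norm_num, show (1 - 1 / 3 : ℝ) = 2 / 3 by norm_num,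
    h1, h2]
  ring

/-- Here 280/817 approximates θ₁, and the two fractions with large denominators bracket ρ₀. Any test
point bounds `H4` above, whereas a lower bound uses the exact minimizer. So ρ is chosen as `meanDeg
(809 / 1280)` at the upper end, and by 1 - 2ρ = `meanDeg (263 / 371)` at the lower end; each point
also serves as test point at the opposite end. -/
theorem H4_complement_upper_lt :
    H4 (1 - 2 * (1529787449 / 4789828409)) < 1 + H2 (1 - 2 * (280 / 817)) := by
  refine lt_of_mul_lt_mul_right ?_ (Real.log_pos one_lt_two).le
  refine (H4_mul_log_two_le (y := 263 / 371) (by norm_num) (by norm_num) (by norm_num)).trans_lt ?_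
  rw [add_mul, H2_mul_log_two, binEntropy_one_sub_two_mul_angle]
  have h1 := log_lowerPoint_bounds
  have h2 := log_lowerPoint_sum_bounds
  have h3 := log_angle_bounds
  have h4 := log_one_sub_two_mul_angle_bounds
  norm_num at *
  linarith [Real.log_two_gt_d9, Real.log_two_lt_d9]

theorem entropySum_angle_le : entropySum (280 / 817) ≤ H4 (1529787449 / 4789828409) := by
  refine le_of_mul_le_mul_right ?_ (Real.log_pos one_lt_two)
  rw [entropySum, add_mul, H2_mul_log_two, H2_mul_log_two, binEntropy_one_sub_two_mul_angle,
    binEntropy_angle, ← meanDeg_upperPoint, H4_meanDeg_mul_log_two (by norm_num),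
    meanDeg_upperPoint]
  have h1 := log_upperPoint_bounds
  have h2 := log_upperPoint_sum_bounds
  have h3 := log_angle_bounds
  have h4 := log_one_sub_two_mul_angle_bounds
  have h5 := log_one_sub_angle_bounds
  norm_num at *
  linarith [Real.log_two_gt_d9, Real.log_two_lt_d9]

theorem lt_H4_complement_lower :
    1 + H2 (1 - 2 * (280 / 817)) < H4 (1 - 2 * (41875883 / 131117540)) := by
  refine lt_of_mul_lt_mul_right ?_ (Real.log_pos one_lt_two).le
  rw [add_mul, H2_mul_log_two, binEntropy_one_sub_two_mul_angle, ← meanDeg_lowerPoint,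
    H4_meanDeg_mul_log_two (by norm_num), meanDeg_lowerPoint]
  have h1 := log_lowerPoint_bounds
  have h2 := log_lowerPoint_sum_bounds
  have h3 := log_angle_bounds
  have h4 := log_one_sub_two_mul_angle_bounds
  norm_num at *
  linarith [Real.log_two_gt_d9, Real.log_two_lt_d9]

theorem H4_lower_le : H4 (41875883 / 131117540) ≤ entropySum (280 / 817) := by
  refine le_of_mul_le_mul_right ?_ (Real.log_pos one_lt_two)
  refine (H4_mul_log_two_le (y := 809 / 1280) (by norm_num) (by norm_num) (by norm_num)).trans ?_
  rw [entropySum, add_mul, H2_mul_log_two, H2_mul_log_two, binEntropy_one_sub_two_mul_angle,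
    binEntropy_angle]
  have h1 := log_upperPoint_bounds
  have h2 := log_upperPoint_sum_bounds
  have h3 := log_angle_bounds
  have h4 := log_one_sub_two_mul_angle_bounds
  have h5 := log_one_sub_angle_bounds
  norm_num at *
  linarith [Real.log_two_gt_d9, Real.log_two_lt_d9]

theorem H4_complement_lower_lt_third :
    H4 (1 - 2 * (41875883 / 131117540)) < 1 + H2 (1 - 2 * (1 / 3)) := by
  refine lt_of_mul_lt_mul_right ?_ (Real.log_pos one_lt_two).le
  rw [add_mul, H2_mul_log_two, binEntropy_third, ← meanDeg_lowerPoint,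
    H4_meanDeg_mul_log_two (by norm_num), meanDeg_lowerPoint]
  have h1 := log_lowerPoint_bounds
  have h2 := log_lowerPoint_sum_bounds
  have h3 := log_three_halves_bounds
  norm_num at *
  linarith [Real.log_two_gt_d9, Real.log_two_lt_d9]

theorem two_rpow_H4_upper_lt : (2 : ℝ) ^ H4 (1529787449 / 4789828409) < 708995 / 200000 := by
  rw [← Real.log_lt_log_iff (by positivity) (by norm_num), Real.log_rpow two_pos]
  refine (H4_mul_log_two_le (y := 809 / 1280) (by norm_num) (by norm_num)
    (by norm_num)).trans_lt ?_
  have h1 := log_upperPoint_bounds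
  have h2 := log_upperPoint_sum_bounds
  have h3 := log_upperValue_bounds
  norm_num at *
  linarith

/-- At the lower end only 1 - 2ρ has a rational minimizer at hand. A slightly smaller ρ with
rational minimizer 529/837 supplies the lower bound for `H4` instead. -/
theorem lt_two_rpow_H4_aux : 708985 / 200000 < (2 : ℝ) ^ H4 (213860417 / 669620030) := by
  rw [← Real.log_lt_log_iff (by norm_num) (by positivity), Real.log_rpow two_pos,
    ← meanDeg_auxPoint, H4_meanDeg_mul_log_two (by norm_num), meanDeg_auxPoint]
  have h1 := log_auxPoint_bounds
  have h2 := log_auxPoint_sum_bounds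
  have h3 := log_lowerValue_bounds
  norm_num at *
  linarith

theorem two_rpow_H4_third_bounds :
    3.61 < (2 : ℝ) ^ H4 (1 / 3) ∧ (2 : ℝ) ^ H4 (1 / 3) < 3.611 := by
  have e : ∀ y : ℝ, 0 < y → weight4 (1 / 3) y = (1 + y + y ^ 2 + y ^ 3) / y := by
    intro y hy
    rw [weight4, show -3 * (1 / 3 : ℝ) = -1 by norm_num, Real.rpow_neg_one, inv_mul_eq_div]
  constructor
  · obtain ⟨y, hy, hye⟩ := (isLeast_two_rpow_H4 (ρ := 1 / 3) (by norm_num)).1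
    have hy : 0 < y := hy
    rw [← hye, e y hy, lt_div_iff₀ hy]
    -- 0.657 approximates the minimizer, so the cubic 1 + y + y² + y³ - 3.61y is nearly a positive
    -- multiple of (y - 0.657)².
    nlinarith [mul_nonneg hy.le (sq_nonneg (y - 0.657)), sq_nonneg (y - 0.657)]
  · refine (two_rpow_H4_le (y := 0.657) (by norm_num) (by norm_num) (by norm_num)).trans_lt ?_
    rw [e _ (by norm_num)]
    norm_num

/-! ### Existence of the solution -/

/-- Beyond 1/3 the derivative of the entropy sum is negative: its sign is that of (1-x)(1-2x)² -
4x³. -/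
theorem IsMaxPoint.le_third {x₀ : ℝ} (h : IsMaxPoint x₀) : x₀ ≤ 1 / 3 := by
  by_contra! hlt
  obtain ⟨hx, hm⟩ := isMaxPoint_iff.mp h
  have hd : ∀ x ∈ Ioo (0 : ℝ) (1 / 2), HasDerivAt (fun θ => Real.binEntropy θ +
      Real.binEntropy (1 - 2 * θ)) ((Real.log (1 - x) - Real.log x) +
      (Real.log (1 - (1 - 2 * x)) - Real.log (1 - 2 * x)) * (-(2 * 1))) x := by
    intro x hx
    refine (Real.hasDerivAt_binEntropy hx.1.ne' (by linarith [hx.2])).add ?_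
    exact HasDerivAt.comp x (Real.hasDerivAt_binEntropy (by linarith [hx.2]) (by linarith [hx.1]))
      (((hasDerivAt_id x).const_mul 2).const_sub 1)
  have hanti : StrictAntiOn (fun θ => Real.binEntropy θ + Real.binEntropy (1 - 2 * θ))
      (Icc (1 / 3) (1 / 2)) := by
    refine strictAntiOn_of_deriv_neg (convex_Icc _ _) (Continuous.continuousOn (by fun_prop)) ?_
    intro x hx
    rw [interior_Icc] at hx
    have hx0 : 0 < x := by linarith [hx.1]
    have h1 : 0 < 1 - x := by linarith [hx.2]
    have h2 : 0 < 1 - 2 * x := by linarith [hx.2]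
    rw [(hd x ⟨hx0, hx.2⟩).deriv, sub_sub_cancel]
    have h3 : Real.log ((1 - x) * (1 - 2 * x) ^ 2) < Real.log (x * (2 * x) ^ 2) := by
      refine Real.log_lt_log (by positivity) ?_
      have hs := sub_pos.mpr hx.1
      nlinarith [mul_pos hs h2, mul_pos hs h1, mul_pos (mul_pos hs h2) h1,
        mul_pos (mul_pos hs h2) h2]
    rw [Real.log_mul (by positivity) (by positivity), Real.log_mul (by positivity) (by positivity),
      Real.log_pow, Real.log_pow] at h3
    push_cast at h3
    linarith
  have h1 := hanti ⟨le_rfl, by norm_num⟩ ⟨hlt.le, hx.2⟩ hlt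
  have h2 := hm (1 / 3) (by norm_num)
  have h3 := mul_le_mul_of_nonneg_right h2 (Real.log_pos one_lt_two).le
  simp only [entropySum, add_mul, H2_mul_log_two] at h3
  exact absurd h1 (not_lt.mpr h3)

theorem one_lt_H4_third : 1 < H4 (1 / 3) := by
  by_contra! h
  have := Real.rpow_le_rpow_of_exponent_le one_le_two h
  rw [Real.rpow_one] at this
  linarith [two_rpow_H4_third_bounds.1]

theorem IsCompact.continuousOn_invFunOn {f : ℝ → ℝ} {K : Set ℝ} (hK : IsCompact K)
    (hc : ContinuousOn f K) (hf : InjOn f K) :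
    ContinuousOn (Function.invFunOn f K) (f '' K) := by
  have hl := hf.leftInvOn_invFunOn
  rw [continuousOn_iff_isClosed]
  intro t ht
  refine ⟨f '' (K ∩ t), ((hK.inter_right ht).image_of_continuousOn
    (hc.mono inter_subset_left)).isClosed, ?_⟩
  ext y
  constructor
  · rintro ⟨hy, x, hx, rfl⟩
    rw [mem_preimage, hl hx] at hy
    exact ⟨⟨x, ⟨hx, hy⟩, rfl⟩, x, hx, rfl⟩
  · rintro ⟨⟨x, ⟨hx, hxt⟩, rfl⟩, -⟩
    exact ⟨by rwa [mem_preimage, hl hx], x, hx, rfl⟩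

/-- The second equation determines θ as a continuous function of ρ by inverting `H2 (1 - 2θ)` on
[1/3, 1/2]. Substituted into the first equation, it leaves one function of ρ whose signs at the two
ends follow by comparison with θ = 280/817. -/
theorem exists_solution {x₀ : ℝ} (hx₀ : IsMaxPoint x₀) :
    ∃ θ ρ : ℝ, SolvesSystem x₀ θ ρ ∧ 1 / 3 ≤ θ ∧ θ < 1 / 2 ∧
      41875883 / 131117540 ≤ ρ ∧ ρ ≤ 1529787449 / 4789828409 := by
  have hl0 : (1 / 4 : ℝ) < 41875883 / 131117540 := by norm_num
  have hlu : (41875883 / 131117540 : ℝ) ≤ 1529787449 / 4789828409 := by norm_num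
  have hu0 : (1529787449 / 4789828409 : ℝ) < 1 / 3 := by norm_num
  have e1 := H4_complement_upper_lt
  have e2 := entropySum_angle_le
  have e3 := lt_H4_complement_lower
  have e4 := H4_lower_le
  have e5 := H4_complement_lower_lt_third
  generalize (41875883 / 131117540 : ℝ) = ρl at *
  generalize (1529787449 / 4789828409 : ℝ) = ρu at *
  set K : Set ℝ := Icc (1 / 3) (1 / 2) with hK
  set f : ℝ → ℝ := fun θ => 1 + H2 (1 - 2 * θ) with hf
  have hfa : StrictAntiOn f K := fun a ha b hb hab =>
    add_lt_add_right (strictAntiOn_H2_one_sub ⟨by linarith [ha.1], ha.2⟩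
      ⟨by linarith [hb.1], hb.2⟩ hab) 1
  have hfc : Continuous f := continuous_const.add (continuous_H2.comp (by fun_prop))
  have hf1 : f (1 / 2) = 1 := by simp [hf, H2]
  have him : Icc 1 (f (1 / 3)) ⊆ f '' K := by
    have := intermediate_value_Icc' (by norm_num : (1 / 3 : ℝ) ≤ 1 / 2) hfc.continuousOn
    rwa [hf1] at this
  set g := Function.invFunOn f K
  have hgK : ∀ y ∈ f '' K, g y ∈ K := fun y hy => Function.invFunOn_mem hy
  have hgf : ∀ y ∈ f '' K, f (g y) = y := fun y hy => Function.invFunOn_eq hy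
  have hgc : ContinuousOn g (f '' K) :=
    isCompact_Icc.continuousOn_invFunOn hfc.continuousOn hfa.injOn
  have hmem : ∀ ρ ∈ Icc ρl ρu, 1 < H4 (1 - 2 * ρ) ∧ H4 (1 - 2 * ρ) ∈ f '' K := by
    intro ρ hρ
    have h1 : H4 (1 / 3) < H4 (1 - 2 * ρ) := strictMonoOn_H4 (by norm_num)
      ⟨by linarith [hρ.2], by linarith [hρ.1]⟩ (by linarith [hρ.2])
    have h2 : H4 (1 - 2 * ρ) ≤ H4 (1 - 2 * ρl) := strictMonoOn_H4.monotoneOn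
      ⟨by linarith [hρ.2], by linarith [hρ.1]⟩ ⟨by linarith, by linarith⟩ (by linarith [hρ.1])
    have h3 := one_lt_H4_third.trans h1
    exact ⟨h3, him ⟨h3.le, h2.trans e5.le⟩⟩
  have hca : ContinuousOn (fun ρ => H4 (1 - 2 * ρ)) (Icc ρl ρu) :=
    continuousOn_H4.comp (by fun_prop) fun ρ hρ => ⟨by linarith [hρ.2], by linarith [hρ.1]⟩
  have hce : Continuous entropySum :=
    continuous_H2.add (continuous_H2.comp (by fun_prop))
  have hc : ContinuousOn (fun ρ => H4 ρ - entropySum (g (H4 (1 - 2 * ρ)))) (Icc ρl ρu) :=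
    (continuousOn_H4.mono fun ρ hρ => ⟨by linarith [hρ.1], by linarith [hρ.2]⟩).sub
      (hce.comp_continuousOn (hgc.comp hca fun ρ hρ => (hmem ρ hρ).2))
  have hθ : (280 / 817 : ℝ) ∈ K := by rw [hK]; norm_num
  have hx3 := hx₀.le_third
  have hanti : AntitoneOn entropySum K := fun a ha b hb hab =>
    (strictAntiOn_entropySum hx₀).antitoneOn ⟨hx3.trans ha.1, ha.2⟩ ⟨hx3.trans hb.1, hb.2⟩ hab
  obtain ⟨ρ, hρ, hρ0⟩ := intermediate_value_Icc hlu hc (show (0 : ℝ) ∈ Icc _ _ from ⟨by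
      have hm := (hmem ρl ⟨le_rfl, hlu⟩).2
      have h1 : g (H4 (1 - 2 * ρl)) ≤ 280 / 817 := by
        rw [← hfa.le_iff_ge hθ (hgK _ hm), hgf _ hm]
        exact e3.le
      have h2 := hanti (hgK _ hm) hθ h1
      linarith, by
      have hm := (hmem ρu ⟨hlu, le_rfl⟩).2
      have h1 : 280 / 817 ≤ g (H4 (1 - 2 * ρu)) := by
        rw [← hfa.le_iff_ge (hgK _ hm) hθ, hgf _ hm]
        exact e1.le
      have h2 := hanti hθ (hgK _ hm) h1
      linarith⟩)
  obtain ⟨hlt, hm⟩ := hmem ρ hρ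
  have hθK := hgK _ hm
  have hθf := hgf _ hm
  refine ⟨g (H4 (1 - 2 * ρ)), ρ, ⟨⟨hx3.trans hθK.1, hθK.2⟩,
    ⟨by linarith [hρ.1], by linarith [hρ.2]⟩, sub_eq_zero.mp hρ0, hθf.symm⟩, hθK.1, ?_,
    hρ.1, hρ.2⟩
  -- θ = 1/2 would give `H4 (1 - 2ρ)` = 1, but 1 - 2ρ > 1/3 and `H4 (1 / 3)` > 1.
  refine lt_of_le_of_ne hθK.2 fun he => ?_
  rw [he, hf1] at hθf
  exact hlt.ne hθf

/-! ### The main theorem -/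

theorem theorem1 :
    -- `2 ^ H4 ρ` is the minimum of `x ^ (-3ρ) (1 + x + x² + x³)` over `x > 0`
    (∀ ρ ∈ Ioo (0 : ℝ) 1, IsLeast (weight4 ρ '' Ioi 0) ((2 : ℝ) ^ H4 ρ)) ∧
    -- `x₀` is the unique maximum point, and `(θ₁, ρ₀)` the unique solution of the system
    ∃ x₀ : ℝ, IsMaxPoint x₀ ∧ (∀ x : ℝ, IsMaxPoint x → x = x₀) ∧
    ∃ θ₁ ρ₀ : ℝ, SolvesSystem x₀ θ₁ ρ₀ ∧
      (∀ θ ρ : ℝ, SolvesSystem x₀ θ ρ → θ = θ₁ ∧ ρ = ρ₀) ∧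
      |ρ₀ - 0.32| < 0.005 ∧
      |2 * (2 : ℝ) ^ H4 ρ₀ - 7.0899| < 0.00005 ∧
      (∀ (n : ℕ) (A : Finset (C8pow n)), ProgressionFree (A : Set (C8pow n)) →
        (A.card : ℝ) ≤ (2 * (2 : ℝ) ^ H4 ρ₀) ^ n) ∧
      (∀ n : ℕ, (r3 (C8pow n) : ℝ) ≤ (7.09 : ℝ) ^ n) ∧
      -- the improvement over the previous bound `(2 κ₄) ^ n`, where `κ₄ = 2 ^ H4 (1 / 3)`
      |2 * (2 : ℝ) ^ H4 (1 / 3) - 7.22| < 0.005 ∧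
      (7.09 : ℝ) < 2 * (2 : ℝ) ^ H4 (1 / 3) := by
  obtain ⟨x₀, hx₀⟩ := exists_isMaxPoint
  obtain ⟨θ, ρ, hsol, hθ, hθ', hρl, hρu⟩ := exists_solution hx₀
  have hl : 7.08985 < 2 * (2 : ℝ) ^ H4 ρ := by
    have h1 : H4 (213860417 / 669620030) ≤ H4 ρ := by
      refine strictMonoOn_H4.monotoneOn (by norm_num) ⟨by linarith, by linarith⟩ ?_
      refine le_trans ?_ hρl
      norm_num
    have h2 := Real.rpow_le_rpow_of_exponent_le one_le_two h1
    linarith [lt_two_rpow_H4_aux]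
  have hu : 2 * (2 : ℝ) ^ H4 ρ < 7.08995 := by
    have h1 : H4 ρ ≤ H4 (1529787449 / 4789828409) :=
      strictMonoOn_H4.monotoneOn ⟨by linarith, by linarith⟩ (by norm_num) hρu
    have h2 := Real.rpow_le_rpow_of_exponent_le one_le_two h1
    linarith [two_rpow_H4_upper_lt]
  have hcard : ∀ (n : ℕ) (A : Finset (C8pow n)), ProgressionFree (A : Set (C8pow n)) →
      (A.card : ℝ) ≤ (2 * (2 : ℝ) ^ H4 ρ) ^ n := fun n A hA =>
    hA.card_le_pow hθ hθ' hsol.2.1.1 (by linarith) hsol.2.2.1 hsol.2.2.2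
  refine ⟨fun ρ hρ => isLeast_two_rpow_H4 hρ, x₀, hx₀, fun x hx => hx.unique hx₀, θ, ρ, hsol,
    fun θ' ρ' h => h.unique hx₀ hsol, ?_, ?_, hcard, fun n => ?_, ?_, ?_⟩
  · rw [abs_lt]
    constructor <;> linarith
  · rw [abs_lt]
    constructor <;> linarith
  · have hne : {k : ℕ | ∃ A : Finset (C8pow n), ProgressionFree (A : Set (C8pow n)) ∧
        A.card = k}.Nonempty := ⟨0, ∅, by simp [ProgressionFree], rfl⟩
    have hb : BddAbove {k : ℕ | ∃ A : Finset (C8pow n), ProgressionFree (A : Set (C8pow n)) ∧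
        A.card = k} := by
      refine ⟨Fintype.card (C8pow n), ?_⟩
      rintro _ ⟨A, -, rfl⟩
      exact Finset.card_le_univ A
    obtain ⟨A, hA, hk⟩ := Nat.sSup_mem hne hb
    rw [r3, ← hk]
    exact (hcard n A hA).trans (pow_le_pow_left₀ (by positivity) (by linarith) n)
  · have h := two_rpow_H4_third_bounds
    rw [abs_lt]
    constructor <;> linarith [h.1, h.2]
  · linarith [two_rpow_H4_third_bounds.1]
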